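/- **Theorem 3.6 (Integrals in $V\subseteq B(H;K)$).** Let $(\Sigma,\mathscr H,\rho)$ be a measure space, let $H,K$ be complex Hilbert spaces (inner products linear in the first variable), let $V\subseteq B(H;K)$ be a linear subspace, let $F\colon\Sigma\to V$ be a map, and let $\mathcal T\in\{\mathrm{WOT},\mathrm{SOT},\mathrm{S^*OT}\}$, the weak, strong or strong$^*$ operator topology on $V$. The topology $\sigma$-$\mathcal T$ on $V$ is the corresponding $\sigma$-weak, $\sigma$-strong or $\sigma$-strong$^*$ operator topology. *Definitions.* If $E$ is a Hausdorff locally convex space with dual $E^*$, then $\sigma(E^*)$ is the $\sigma$-algebra on $E$ generated by $E^*$. A map $f\colon\Sigma\to E$ is *weakly measurable* if it is $(\mathscr H,\sigma(E^*))$-measurable. It is *Gel'fand–Pettis integrable* if it is weakly measurable, $\int_\Sigma|\ell\circ f|\,d\rho<\infty$ for all $\ell\in E^*$, and for every $S\in\mathscr H$ there is $\int_Sf\,d\rho\in E$ with $\ell(\int_Sf\,d\rho)=\int_S\ell\circ f\,d\rho$ for all $\ell\in E^*$. The map $F$ is *pointwise weakly measurable* if $\langle F(\cdot)h,k\rangle_K$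 is measurable for all $h\in H$, $k\in K$. It is *pointwise Pettis integrable* if moreover $\int_\Sigma|\langle F(\sigma)h,k\rangle_K|\,\rho(d\sigma)<\infty$ for all $h,k$; its pointwise Pettis integral $\rho_S(F)\in B(H;K)$, $S\in\mathscr H$, is then given by $\rho_S(F)h=\int_SF(\sigma)h\,\rho(d\sigma)$, a Gel'fand–Pettis integral in $K$. It is *pointwise Pettis integrable in $V$* if in addition $\rho_S(F)\in V$ for all $S\in\mathscr H$. For arbitrary $g\colon\Sigma\to[0,\infty]$, the lower integral $\underline{\int_\Sigma}g\,d\rho$ is the supremum of $\int_\Sigma\tilde g\,d\rho$ over measurable $\tilde g\colon\Sigma\to[0,\infty]$ with $\tilde g\le g$ $\rho$-a.e. Write $\mathcal S_1(K;H)$ for the trace class operators $K\to H$. Let $V_*=(V,\sigma\text{-}\mathrm{WOT})^*$ with the operator norm. When $V$ is $\sigma$-weakly closed, $F$ is *weak$^*$ integrable* if $\sigma\mapsto(\ell\mapsto\ell(F(\sigma)))$ is Gel'fand–Pettis integrable as a map into $V_*^{\;*}$ with its weak$^*$ topology; via the identification $V\cong V_*^{\;*}$, $A\mapsto(\ell\mapsto\ell(A))$,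 the corresponding integrals are regarded as elements of $V$. (i) The $\sigma$-algebras on $V$ generated by $\{A\mapsto\operatorname{Tr}(AB):B\in\mathcal S_1(K;H)\}$ and by $\{A\mapsto\langle Ah,k\rangle_K:h\in H,k\in K\}$ coincide, and they are equal to $\sigma((V,\sigma\text{-}\mathcal T)^*)$ and to $\sigma((V,\mathcal T)^*)$. In particular, $F$ is pointwise weakly measurable if and only if it is weakly measurable in $\mathcal T$, if and only if it is weakly measurable in $\sigma$-$\mathcal T$. (ii) $F$ is pointwise Pettis integrable in $V$ if and only if it is Gel'fand–Pettis integrable in $\mathcal T$. In this case the two kinds of integrals over every $S\in\mathscr H$ agree, and $$\Big\|\int_\Sigma F\,d\rho\Big\|\le\underline{\int_\Sigma}\|F\|\,d\rho .$$ (iii) Suppose that $V$ is $\sigma$-weakly closed in $B(H;K)$. Then $F$ is Gel'fand–Pettis integrable in $\sigma$-$\mathcal T$ if and only if it is weak$^*$ integrable, if and only if it is pointwise weakly measurable and $$\int_\Sigma\big|\big\langle(F(\sigma)h_n)_{n},(k_n)_{n}\big\rangle_{\ell^2(\mathbb N;K)}\big|\,\rho(d\sigma)<\infty$$ for all $(h_n)_n\in\ell^2(\mathbb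 N;H)$ and $(k_n)_n\in\ell^2(\mathbb N;K)$. In this case $F$ is pointwise Pettis integrable in $V$, and the Gel'fand–Pettis, weak$^*$ and pointwise Pettis integrals of $F$ over every $S\in\mathscr H$ agree. (iv) Let $\mathcal M\subseteq B(H)$ be a von Neumann algebra, let $F\colon\Sigma\to\mathcal M$ be a map, let $\mathcal N\subseteq B(L)$ be a von Neumann algebra on another complex Hilbert space $L$, and let $\pi\colon\mathcal M\to\mathcal N$ be an algebraic $*$-isomorphism. Then $F$ is pointwise weakly measurable if and only if $\pi\circ F$ is, and $F$ is Gel'fand–Pettis integrable in $\sigma$-$\mathcal T$ if and only if $\pi\circ F$ is. In the latter case $\int_S(\pi\circ F)\,d\rho=\pi\big(\int_SF\,d\rho\big)$ for all $S\in\mathscr H$. -/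

import Mathlib

open MeasureTheory
open scoped ENNReal Topology

noncomputable section

namespace WeakInt

/-! ### Upper and lower integrals, weak measurability, Gel'fand–Pettis integrals -/

section General

variable {Ω : Type*} [MeasurableSpace Ω]

/-- The lower integral of an arbitrary function `h : Ω → [0,∞]`. -/
def lowerIntegral (ρ : Measure Ω) (h : Ω → ℝ≥0∞) : ℝ≥0∞ :=
  ⨆ (g : Ω → ℝ≥0∞) (_ : Measurable g) (_ : ∀ᵐ ω ∂ρ, g ω ≤ h ω), ∫⁻ ω, g ω ∂ρ

variable {E : Type*} [AddCommMonoid E] [Module ℂ E]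

/-- The topological dual of `(E, t)`: the linear functionals `E → ℂ` that are continuous with
respect to the topology `t`. The topology is an explicit argument, since one and the same space
is considered with several topologies. -/
def topDual (t : TopologicalSpace E) : Set (E →ₗ[ℂ] ℂ) :=
  {ℓ | Continuous[t, inferInstance] ℓ}

/-- The `σ`-algebra on `X` generated by a set of functions `X → ℂ`. -/
@[reducible]
def sigmaGenBy {X : Type*} (L : Set (X → ℂ)) : MeasurableSpace X :=
  ⨆ f ∈ L, MeasurableSpace.comap f (borel ℂ)

/-- The `σ`-algebra `σ((E, t)^*)` on `E` generated by the continuous linear functionals. -/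
@[reducible]
def sigmaDual (t : TopologicalSpace E) : MeasurableSpace E :=
  sigmaGenBy {f : E → ℂ | ∃ ℓ ∈ topDual t, f = ℓ}

/-- Weak measurability of `f : Ω → (E, t)`. -/
def WeaklyMeasurable (t : TopologicalSpace E) (f : Ω → E) : Prop :=
  Measurable[inferInstance, sigmaDual t] f

/-- `v` is a weak (Gel'fand–Pettis) integral over `S` of `f : Ω → (E, t)`. -/
def IsWeakIntegral (t : TopologicalSpace E) (ρ : Measure Ω) (f : Ω → E) (S : Set Ω) (v : E) :
    Prop :=
  ∀ ℓ ∈ topDual t, ℓ v = ∫ ω in S, ℓ (f ω) ∂ρ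

/-- Weak (Gel'fand–Pettis) integrability of `f : Ω → (E, t)`. -/
structure WeaklyIntegrable (t : TopologicalSpace E) (ρ : Measure Ω) (f : Ω → E) : Prop where
  weaklyMeasurable : WeaklyMeasurable t f
  lintegral_lt_top : ∀ ℓ ∈ topDual t, ∫⁻ ω, ‖ℓ (f ω)‖ₑ ∂ρ < ∞
  exists_integral : ∀ S, MeasurableSet S → ∃ v, IsWeakIntegral t ρ f S v

end General

/-! ### Operator topologies -/

section OperatorTopologies

open ContinuousLinearMap (adjoint)

variable {H K : Type*} [NormedAddCommGroup H] [InnerProductSpace ℂ H]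
  [NormedAddCommGroup K] [InnerProductSpace ℂ K]

/-- The names of the three operator topologies WOT, SOT, S*OT. -/
inductive OpTop : Type
  | weak
  | strong
  | strongStar

/-- `ℓ²(ℕ; H)`. -/
abbrev ell2 (H : Type*) [NormedAddCommGroup H] : Type _ := lp (fun _ : ℕ => H) 2

/-- The operator `(hₙ)ₙ ↦ (A hₙ)ₙ` from `ℓ²(ℕ; H)` to `ℓ²(ℕ; K)`. -/
def ampl (A : H →L[ℂ] K) : ell2 H →L[ℂ] ell2 K :=
  lp.mapCLM 2 (fun _ : ℕ => A) (norm_nonneg A) (fun _ => le_rfl)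

theorem ampl_apply (A : H →L[ℂ] K) (h : ell2 H) (n : ℕ) : ampl A h n = A (h n) := rfl

theorem ampl_add (A B : H →L[ℂ] K) (h : ell2 H) : ampl (A + B) h = ampl A h + ampl B h := by
  ext n; simp [ampl_apply]

theorem ampl_smul (c : ℂ) (A : H →L[ℂ] K) (h : ell2 H) : ampl (c • A) h = c • ampl A h := by
  ext n; simp [ampl_apply]

variable [CompleteSpace H] [CompleteSpace K]

/-- `A ↦ |⟨A h, k⟩|`. -/
def wotSeminorm (p : H × K) : Seminorm ℂ (H →L[ℂ] K) :=
  Seminorm.of (fun A => ‖inner ℂ p.2 (A p.1)‖)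
    (fun A B => by simpa [inner_add_right] using norm_add_le _ _)
    (fun c A => by simp)

/-- `A ↦ ‖A h‖`. -/
def sotSeminorm (h : H) : Seminorm ℂ (H →L[ℂ] K) :=
  Seminorm.of (fun A => ‖A h‖)
    (fun A B => by simpa using norm_add_le _ _)
    (fun c A => by simp [norm_smul])

/-- `A ↦ ‖A h‖ + ‖A* k‖`. -/
def sstarotSeminorm (p : H × K) : Seminorm ℂ (H →L[ℂ] K) :=
  Seminorm.of (fun A => ‖A p.1‖ + ‖adjoint A p.2‖)
    (fun A B => by
      have h1 := norm_add_le (A p.1) (B p.1)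
      have h2 := norm_add_le (adjoint A p.2) (adjoint B p.2)
      simp only [map_add, add_apply]
      linarith)
    (fun c A => by rw [map_smulₛₗ]; simp [norm_smul, mul_add])

/-- `A ↦ |⟨(A hₙ)ₙ, (kₙ)ₙ⟩|`. -/
def sigmaWotSeminorm (p : ell2 H × ell2 K) : Seminorm ℂ (H →L[ℂ] K) :=
  Seminorm.of (fun A => ‖inner ℂ p.2 (ampl A p.1)‖)
    (fun A B => by simpa [ampl_add, inner_add_right] using norm_add_le _ _)
    (fun c A => by simp [ampl_smul])

/-- `A ↦ ‖(A hₙ)ₙ‖`. -/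
def sigmaSotSeminorm (h : ell2 H) : Seminorm ℂ (H →L[ℂ] K) :=
  Seminorm.of (fun A => ‖ampl A h‖)
    (fun A B => by simpa [ampl_add] using norm_add_le _ _)
    (fun c A => by simp [ampl_smul, norm_smul])

/-- `A ↦ ‖(A hₙ)ₙ‖ + ‖(A* kₙ)ₙ‖`. -/
def sigmaSstarotSeminorm (p : ell2 H × ell2 K) : Seminorm ℂ (H →L[ℂ] K) :=
  Seminorm.of (fun A => ‖ampl A p.1‖ + ‖ampl (adjoint A) p.2‖)
    (fun A B => by
      have h1 := norm_add_le (ampl A p.1) (ampl B p.1)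
      have h2 := norm_add_le (ampl (adjoint A) p.2) (ampl (adjoint B) p.2)
      simp only [map_add, ampl_add]
      linarith)
    (fun c A => by rw [map_smulₛₗ]; simp [ampl_smul, norm_smul, mul_add])

/-- The topology `𝒯` on `B(H; K)`: the locally convex topology generated by the corresponding
family of seminorms. -/
@[reducible]
def opTopology : OpTop → TopologicalSpace (H →L[ℂ] K)
  | .weak => (SeminormFamily.moduleFilterBasis (𝕜 := ℂ) (wotSeminorm (H := H) (K := K))).topology
  | .strong => (SeminormFamily.moduleFilterBasis (𝕜 := ℂ) (sotSeminorm (H := H) (K := K))).topology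
  | .strongStar =>
    (SeminormFamily.moduleFilterBasis (𝕜 := ℂ) (sstarotSeminorm (H := H) (K := K))).topology

/-- The topology `σ`-`𝒯` on `B(H; K)`. -/
@[reducible]
def sigmaOpTopology : OpTop → TopologicalSpace (H →L[ℂ] K)
  | .weak =>
    (SeminormFamily.moduleFilterBasis (𝕜 := ℂ) (sigmaWotSeminorm (H := H) (K := K))).topology
  | .strong =>
    (SeminormFamily.moduleFilterBasis (𝕜 := ℂ) (sigmaSotSeminorm (H := H) (K := K))).topology
  | .strongStar =>
    (SeminormFamily.moduleFilterBasis (𝕜 := ℂ) (sigmaSstarotSeminorm (H := H) (K := K))).topology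

/-- The topology `𝒯` on a subset `V` of `B(H; K)` (subspace topology). -/
@[reducible]
def opTopologyOn (T : OpTop) {S : Type*} [SetLike S (H →L[ℂ] K)] (V : S) : TopologicalSpace V :=
  (opTopology T).induced Subtype.val

/-- The topology `σ`-`𝒯` on a subset `V` of `B(H; K)` (subspace topology). -/
@[reducible]
def sigmaOpTopologyOn (T : OpTop) {S : Type*} [SetLike S (H →L[ℂ] K)] (V : S) :
    TopologicalSpace V :=
  (sigmaOpTopology T).induced Subtype.val

/-! ### Trace class operators -/

variable (H) in
/-- An orthonormal basis of `H`, as a subset of `H`. -/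
def onbSet : Set H := Classical.choose (exists_hilbertBasis ℂ H)

variable (H) in
/-- The orthonormal basis of `H` (chosen once and for all) whose underlying set is `onbSet H`. -/
def onb : HilbertBasis (onbSet H) ℂ H :=
  Classical.choose (Classical.choose_spec (exists_hilbertBasis ℂ H))

/-- `‖A‖_{𝒮₁} = ∑_e ⟨|A| e, e⟩` with `|A| = (A* A)^{1/2}`. -/
def schattenOneNorm (A : H →L[ℂ] K) : ℝ≥0∞ :=
  ∑' e : onbSet H,
    ENNReal.ofReal (RCLike.re (inner ℂ (onb H e) (CFC.sqrt (adjoint A ∘L A) (onb H e))))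

/-- The trace class `𝒮₁(H; K)`. -/
def traceClass (H K : Type*) [NormedAddCommGroup H] [InnerProductSpace ℂ H] [CompleteSpace H]
    [NormedAddCommGroup K] [InnerProductSpace ℂ K] [CompleteSpace K] : Set (H →L[ℂ] K) :=
  {A | schattenOneNorm A < ∞}

/-- The trace `Tr A = ∑_e ⟨A e, e⟩` (meaningful for `A` in the trace class). -/
def trace (A : H →L[ℂ] H) : ℂ := ∑' e : onbSet H, inner ℂ (onb H e) (A (onb H e))

/-- The `σ`-algebra on `V` generated by the maps `A ↦ Tr(A B)`, `B ∈ 𝒮₁(K; H)`. -/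
@[reducible]
def sigmaTrace (V : Submodule ℂ (H →L[ℂ] K)) : MeasurableSpace V :=
  sigmaGenBy {f : V → ℂ | ∃ B ∈ traceClass K H, f = fun A : V => trace ((A : H →L[ℂ] K) ∘L B)}

/-- The `σ`-algebra on `V` generated by the maps `A ↦ ⟨A h, k⟩`, `h ∈ H`, `k ∈ K`. -/
@[reducible]
def sigmaPointwise (V : Submodule ℂ (H →L[ℂ] K)) : MeasurableSpace V :=
  sigmaGenBy {f : V → ℂ | ∃ (h : H) (k : K), f = fun A : V => inner ℂ k ((A : H →L[ℂ] K) h)}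

/-! ### Pointwise Pettis integrals -/

variable {Ω : Type*} [MeasurableSpace Ω]

/-- Pointwise weak measurability of `F : Ω → B(H; K)`. -/
def PointwiseWeaklyMeasurable (F : Ω → H →L[ℂ] K) : Prop :=
  ∀ (h : H) (k : K), Measurable fun ω => inner ℂ k (F ω h)

/-- Pointwise Pettis integrability of `F : Ω → B(H; K)`. -/
structure PointwisePettisIntegrable (ρ : Measure Ω) (F : Ω → H →L[ℂ] K) : Prop where
  measurable : PointwiseWeaklyMeasurable F
  lintegral_lt_top : ∀ (h : H) (k : K), ∫⁻ ω, ‖inner ℂ k (F ω h)‖ₑ ∂ρ < ∞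

/-- `A = ρ_S(F)`, that is, `A h` is the weak integral over `S` of `F(·) h` in the Hilbert space
`K`, for all `h`. -/
def IsPointwisePettisIntegral (ρ : Measure Ω) (F : Ω → H →L[ℂ] K) (S : Set Ω) (A : H →L[ℂ] K) :
    Prop :=
  ∀ h : H, IsWeakIntegral (E := K) inferInstance ρ (fun ω => F ω h) S (A h)

/-- Pointwise Pettis integrability in `V` of a map `F : Ω → V ⊆ B(H; K)`: the integrals `ρ_S(F)`
belong to `V`. -/
structure PointwisePettisIntegrableIn (V : Submodule ℂ (H →L[ℂ] K)) (ρ : Measure Ω) (F : Ω → V) :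
    Prop where
  integrable : PointwisePettisIntegrable ρ (fun ω => (F ω : H →L[ℂ] K))
  integral_mem : ∀ S, MeasurableSet S →
    ∃ A ∈ V, IsPointwisePettisIntegral ρ (fun ω => (F ω : H →L[ℂ] K)) S A

/-! ### The predual -/

/-- `V_* = (V, σ-WOT)^*`, a space of norm-continuous functionals on `V`, with the operator norm. -/
def predual (V : Submodule ℂ (H →L[ℂ] K)) : Submodule ℂ (StrongDual ℂ V) where
  carrier := {ℓ | Continuous[sigmaOpTopologyOn .weak V, inferInstance] ℓ}
  zero_mem' := by
    let _ := sigmaOpTopologyOn .weak V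
    exact continuous_const
  add_mem' {a b} ha hb := by
    let _ := sigmaOpTopologyOn .weak V
    exact Continuous.add (hf := ha) (hg := hb)
  smul_mem' c a ha := by
    let _ := sigmaOpTopologyOn .weak V
    exact Continuous.const_smul (hg := ha) c

/-- The weak* topology on `V_*^*`. -/
@[reducible]
def weakStarTopology (V : Submodule ℂ (H →L[ℂ] K)) : TopologicalSpace (WeakDual ℂ (predual V)) :=
  inferInstance

/-- The evaluation map `V → V_*^*`, with `V_*^*` carrying the weak* topology. -/
def evPredual (V : Submodule ℂ (H →L[ℂ] K)) (A : V) : WeakDual ℂ (predual V) :=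
  StrongDual.toWeakDual
    ((NormedSpace.inclusionInDoubleDual ℂ V A).comp (predual V).subtypeL)

theorem evPredual_apply (V : Submodule ℂ (H →L[ℂ] K)) (A : V) (ℓ : predual V) :
    evPredual V A ℓ = (ℓ : StrongDual ℂ V) A := rfl

end OperatorTopologies

end WeakInt

end

noncomputable section

set_option linter.unusedSectionVars false

namespace WeakInt

/-! ### Linear functionals dominated by seminorms -/

section Domination

/-! Everything rests on knowing the continuous functionals. By Hahn–Banach and Riesz, WOT, SOT and
S*OT have the same dual, the span of A ↦ ⟨Ah, k⟩ (`mem_of_continuous_of_withSeminorms`,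
`topDual_induced_opTopology`). Amplification to ℓ² exhibits σ-𝒯 as a pullback of 𝒯
(`sigmaOpTopology_eq_induced`), so the σ-duals are spanned by A ↦ ⟨(A hₙ), (kₙ)⟩. Weak measurability
and weak integrals need testing on spanning functionals only, so the choice of 𝒯 drops out. The
generated σ-algebras coincide because ℓ² pairings and traces against trace class operators are
countable sums of vector functionals.

When V is σ-weakly closed, absolute integrability alone produces the integral: the closed graph
theorem gives an operator on ℓ² (`exists_forall_inner_eq_setIntegral`), this operator is an
amplification, and Hahn–Banach places it in V.

A *-isomorphism of von Neumann algebras preserves order, hence suprema of chains in [0, 1]. An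
exhaustion argument then shows that it pulls σ-weakly continuous functionals back to norm limits of
sums of vector functionals (`vectorFun_reprₗ_self_mem`, `vectorFun_ampl_reprₗ_mem`). Integrability
survives such limits: the integrals over all sets are uniformly bounded operators, and a uniform
bound on set integrals controls the L¹ norm, so the approximating scalar functions are Cauchy in L¹
(`integrable_and_integral_eq_of_mem_closedVectorFuns`). -/

theorem exists_add_of_abs_le_add {E : Type*} [AddCommGroup E] [Module ℝ E] (g : E →ₗ[ℝ] ℝ)
    (p q : Seminorm ℝ E) (h : ∀ x, |g x| ≤ p x + q x) :
    ∃ g₁ g₂ : E →ₗ[ℝ] ℝ, g = g₁ + g₂ ∧ (∀ x, |g₁ x| ≤ p x) ∧ ∀ x, |g₂ x| ≤ q x := by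
  -- On the diagonal of E × E, g is dominated by (x, y) ↦ p x + q y. A Hahn–Banach extension to E ×
  -- E splits along the two factors.
  let D : Submodule ℝ (E × E) := LinearMap.range (LinearMap.id.prod LinearMap.id)
  let f : Module.Dual ℝ D := g ∘ₗ LinearMap.fst ℝ E E ∘ₗ D.subtype
  let P : Seminorm ℝ (E × E) := p.comp (LinearMap.fst ℝ E E) + q.comp (LinearMap.snd ℝ E E)
  obtain ⟨G, hG, hGP⟩ := Module.Dual.exists_extension_of_le_seminorm_real D f (p := P) (by
    rintro ⟨_, x, rfl⟩
    exact (le_abs_self _).trans (h x))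
  refine ⟨G ∘ₗ LinearMap.inl ℝ E E, G ∘ₗ LinearMap.inr ℝ E E, ?_, fun x => ?_, fun x => ?_⟩
  · ext x
    have := hG ⟨(x, x), ⟨x, rfl⟩⟩
    simp only [LinearMap.add_apply, LinearMap.comp_apply, LinearMap.inl_apply,
      LinearMap.inr_apply, ← map_add]
    simpa [f] using this.symm
  · simpa [P] using hGP (x, 0)
  · simpa [P] using hGP (0, x)

/-- The bound makes g vanish on ker u, so g factors through u; Hahn–Banach and Riesz for the inner
product Re⟨·,·⟩ represent the factor. Asking only for real linearity of u admits conjugate-linear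
maps such as A ↦ A* k. -/
theorem exists_eq_re_inner {E X : Type*} [AddCommGroup E] [Module ℝ E] [NormedAddCommGroup X]
    [InnerProductSpace ℂ X] [CompleteSpace X] (g : E →ₗ[ℝ] ℝ) (u : E →ₗ[ℝ] X) (C : ℝ)
    (hC : 0 ≤ C) (h : ∀ x, |g x| ≤ C * ‖u x‖) : ∃ y : X, ∀ x, g x = (inner ℂ y (u x)).re := by
  have hmem : g ∈ LinearMap.range u.dualMap := by
    rw [LinearMap.range_dualMap_eq_dualAnnihilator_ker, Submodule.mem_dualAnnihilator]
    intro w hw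
    have := h w
    rw [LinearMap.mem_ker.1 hw, norm_zero, mul_zero] at this
    exact abs_nonpos_iff.1 this
  obtain ⟨f, hf⟩ := hmem
  have hfu : ∀ x, f (u x) = g x := fun x => by rw [← hf]; rfl
  let _ : InnerProductSpace ℝ X := InnerProductSpace.rclikeToReal ℂ X
  obtain ⟨G, hG, hGP⟩ := Module.Dual.exists_extension_of_le_seminorm_real (LinearMap.range u)
    (f ∘ₗ (LinearMap.range u).subtype) (p := C.toNNReal • normSeminorm ℝ X) (by
      rintro ⟨_, x, rfl⟩
      refine (le_abs_self _).trans ((congrArg abs (hfu x)).le.trans ((h x).trans (le_of_eq ?_)))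
      simp [NNReal.smul_def, hC])
  let G' : StrongDual ℝ X := G.mkContinuous C fun x => (hGP x).trans (le_of_eq (by
    simp [NNReal.smul_def, hC]))
  refine ⟨(InnerProductSpace.toDual ℝ X).symm G', fun x => ?_⟩
  have h1 : inner ℝ ((InnerProductSpace.toDual ℝ X).symm G') (u x) = G' (u x) :=
    InnerProductSpace.toDual_symm_apply
  rw [← hfu]
  exact (hG ⟨u x, x, rfl⟩).symm.trans h1.symm

variable {E ι : Type*} [AddCommGroup E] [Module ℂ E]

theorem seminorm_sum_apply (p : ι → Seminorm ℂ E) (s : Finset ι) (x : E) :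
    (∑ i ∈ s, p i) x = ∑ i ∈ s, p i x := by
  classical
  induction s using Finset.induction_on with
  | empty => simp
  | insert i s hi ih => rw [Finset.sum_insert hi, Finset.sum_insert hi, add_apply, ih]

theorem withSeminorms_induced_moduleFilterBasis {F : Type*} [AddCommGroup F] [Module ℂ F]
    [Nonempty ι] (q : SeminormFamily ℂ F ι) (j : E →ₗ[ℂ] F) :
    WithSeminorms (topology := q.moduleFilterBasis.topology.induced j) (q.comp j) :=
  let _ := q.moduleFilterBasis.topology
  LinearMap.withSeminorms_induced ⟨rfl⟩ j

/-- Induction on the number of seminorms, splitting off one at a time by `exists_add_of_abs_le_add`.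
The splitting is only real linear, hence the real parts. -/
theorem exists_mem_re_eq_of_abs_le_sum (p : ι → Seminorm ℂ E) (W : Submodule ℂ (E →ₗ[ℂ] ℂ))
    (hW : ∀ i, ∀ g : E →ₗ[ℝ] ℝ, ∀ C : ℝ, 0 ≤ C → (∀ x, |g x| ≤ C * p i x) →
      ∃ φ ∈ W, ∀ x, g x = (φ x).re) (s : Finset ι) (g : E →ₗ[ℝ] ℝ) (C : NNReal)
    (h : ∀ x, |g x| ≤ C * ∑ i ∈ s, p i x) : ∃ φ ∈ W, ∀ x, g x = (φ x).re := by
  classical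
  induction s using Finset.induction_on generalizing g with
  | empty =>
    refine ⟨0, W.zero_mem, fun x => ?_⟩
    simpa using h x
  | insert i s hi ih =>
    obtain ⟨g₁, g₂, rfl, h₁, h₂⟩ := exists_add_of_abs_le_add g
      (C • (p i).restrictScalars ℝ) (C • (∑ i ∈ s, p i).restrictScalars ℝ) (fun x => by
        refine (h x).trans (le_of_eq ?_)
        rw [Finset.sum_insert hi, mul_add]
        congr 1
        change _ = (C : ℝ) * (∑ i ∈ s, p i) x
        rw [seminorm_sum_apply])
    obtain ⟨φ₁, hφ₁, e₁⟩ := hW i g₁ C C.2 h₁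
    obtain ⟨φ₂, hφ₂, e₂⟩ := ih g₂ (fun x => (h₂ x).trans (le_of_eq (by
        change (C : ℝ) * (∑ i ∈ s, p i) x = _
        rw [seminorm_sum_apply])))
    exact ⟨φ₁ + φ₂, W.add_mem hφ₁ hφ₂, fun x => by simp [e₁, e₂]⟩

theorem linearMap_ext_re {φ ψ : E →ₗ[ℂ] ℂ} (h : ∀ x, (φ x).re = (ψ x).re) : φ = ψ := by
  ext x
  refine Complex.ext (h x) ?_
  have := h (Complex.I • x)
  simpa using this

/-- A continuous functional is bounded by a multiple of a finite sum of seminorms and is determined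
by its real part, so real functionals dominated by a single seminorm decide. -/
theorem mem_of_continuous_of_withSeminorms [t : TopologicalSpace E] {p : SeminormFamily ℂ E ι}
    (hp : WithSeminorms p) (W : Submodule ℂ (E →ₗ[ℂ] ℂ))
    (hW : ∀ i, ∀ g : E →ₗ[ℝ] ℝ, ∀ C : ℝ, 0 ≤ C → (∀ x, |g x| ≤ C * p i x) →
      ∃ φ ∈ W, ∀ x, g x = (φ x).re) (ℓ : E →ₗ[ℂ] ℂ) (hℓ : Continuous ℓ) : ℓ ∈ W := by
  obtain ⟨s, C, -, hC⟩ := Seminorm.bound_of_continuous hp ℓ.toSeminorm hℓ.norm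
  obtain ⟨φ, hφ, e⟩ := exists_mem_re_eq_of_abs_le_sum p W hW s
    (Complex.reLm ∘ₗ ℓ.restrictScalars ℝ) C (fun x => by
      refine (Complex.abs_re_le_norm (ℓ x)).trans ((hC x).trans ?_)
      refine mul_le_mul_of_nonneg_left ?_ C.2
      refine (Seminorm.finset_sup_le_sum p s x).trans (le_of_eq ?_)
      rw [seminorm_sum_apply])
  rwa [linearMap_ext_re (φ := ℓ) (ψ := φ) e]

end Domination

/-! ### The dual of a space of operators with an operator topology -/

section Duals

open ContinuousLinearMap (adjoint)

variable {H K : Type*} [NormedAddCommGroup H] [InnerProductSpace ℂ H]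
  [NormedAddCommGroup K] [InnerProductSpace ℂ K]
variable {E : Type*} [AddCommGroup E] [Module ℂ E]

/-- The functional `A ↦ ⟨j(A) h, k⟩` on a space `E` mapped into `B(H; K)` by `j`. -/
def vectorFun (j : E →ₗ[ℂ] (H →L[ℂ] K)) (h : H) (k : K) : E →ₗ[ℂ] ℂ where
  toFun A := inner ℂ k (j A h)
  map_add' A B := by simp
  map_smul' c A := by simp

@[simp]
theorem vectorFun_apply (j : E →ₗ[ℂ] (H →L[ℂ] K)) (h : H) (k : K) (A : E) :
    vectorFun j h k A = inner ℂ k (j A h) := rfl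

/-- The functionals `A ↦ ⟨j(A) h, k⟩`. -/
def vectorFuns (j : E →ₗ[ℂ] (H →L[ℂ] K)) : Set (E →ₗ[ℂ] ℂ) :=
  Set.range fun p : H × K => vectorFun j p.1 p.2

theorem vectorFun_mem (j : E →ₗ[ℂ] (H →L[ℂ] K)) (h : H) (k : K) :
    vectorFun j h k ∈ vectorFuns j := ⟨(h, k), rfl⟩

/-- `ampl` as a linear map. -/
def amplₗ : (H →L[ℂ] K) →ₗ[ℂ] (ell2 H →L[ℂ] ell2 K) where
  toFun := ampl
  map_add' A B := by ext1 h; exact ampl_add A B h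
  map_smul' c A := by ext1 h; exact ampl_smul c A h

@[simp]
theorem amplₗ_apply (A : H →L[ℂ] K) : amplₗ A = ampl A := rfl

variable [CompleteSpace H] [CompleteSpace K]

theorem adjoint_ampl (A : H →L[ℂ] K) : adjoint (ampl A) = ampl (adjoint A) := by
  symm
  rw [ContinuousLinearMap.eq_adjoint_iff]
  intro k h
  rw [lp.inner_eq_tsum, lp.inner_eq_tsum]
  exact tsum_congr fun n => ContinuousLinearMap.adjoint_inner_left A _ _

theorem exists_vectorFun_re_eq (j : E →ₗ[ℂ] (H →L[ℂ] K)) (g : E →ₗ[ℝ] ℝ) {C : ℝ} (hC : 0 ≤ C)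
    (h : H) (hg : ∀ A, |g A| ≤ C * ‖j A h‖) : ∃ k, ∀ A, g A = (vectorFun j h k A).re := by
  let u : E →ₗ[ℝ] K :=
    { toFun := fun A => j A h, map_add' := fun A B => by simp, map_smul' := fun c A => by simp }
  exact exists_eq_re_inner g u C hC hg

theorem exists_vectorFun_re_eq_of_adjoint (j : E →ₗ[ℂ] (H →L[ℂ] K)) (g : E →ₗ[ℝ] ℝ) {C : ℝ}
    (hC : 0 ≤ C) (k : K) (hg : ∀ A, |g A| ≤ C * ‖adjoint (j A) k‖) :
    ∃ h, ∀ A, g A = (vectorFun j h k A).re := by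
  let u : E →ₗ[ℝ] H :=
    { toFun := fun A => adjoint (j A) k
      map_add' := fun A B => by simp
      map_smul' := fun c A => by
        rw [← Complex.coe_smul, map_smul, map_smulₛₗ]
        simp }
  obtain ⟨y, hy⟩ := exists_eq_re_inner g u C hC hg
  refine ⟨y, fun A => ?_⟩
  rw [hy, vectorFun_apply]
  change (inner ℂ y (adjoint (j A) k)).re = _
  rw [ContinuousLinearMap.adjoint_inner_right]
  exact inner_re_symm (𝕜 := ℂ) _ _

/-- The map j is arbitrary so that one argument serves V, its amplification to ℓ² and von Neumann
algebras. -/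
theorem topDual_eq_span_vectorFuns (j : E →ₗ[ℂ] (H →L[ℂ] K)) {ι : Type*} [Nonempty ι]
    (q : SeminormFamily ℂ (H →L[ℂ] K) ι)
    (hW : ∀ i, ∀ g : E →ₗ[ℝ] ℝ, ∀ C : ℝ, 0 ≤ C → (∀ A, |g A| ≤ C * q i (j A)) →
      ∃ φ ∈ Submodule.span ℂ (vectorFuns j), ∀ A, g A = (φ A).re)
    (hb : ∀ h k, ∃ i, ∃ C : NNReal, ∀ A : H →L[ℂ] K, ‖inner ℂ k (A h)‖ ≤ C * q i A) :
    topDual (q.moduleFilterBasis.topology.induced j) = Submodule.span ℂ (vectorFuns j) := by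
  have hp := withSeminorms_induced_moduleFilterBasis q j
  let t := q.moduleFilterBasis.topology.induced j
  refine Set.Subset.antisymm (fun ℓ hℓ => mem_of_continuous_of_withSeminorms hp _ hW ℓ hℓ) ?_
  intro ℓ hℓ
  change Continuous[t, inferInstance] ℓ
  rw [SetLike.mem_coe] at hℓ
  induction hℓ using Submodule.span_induction with
  | mem x hx =>
    obtain ⟨⟨h, k⟩, rfl⟩ := hx
    obtain ⟨i, C, hC⟩ := hb h k
    refine hp.continuous_normedSpace_rng ℂ (vectorFun j h k) ⟨{i}, C, ?_⟩
    intro A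
    rw [Finset.sup_singleton]
    exact hC (j A)
  | zero => exact continuous_const
  | add a b _ _ ha hb => exact Continuous.add (hf := ha) (hg := hb)
  | smul c a _ ha => exact Continuous.const_smul (hg := ha) c

theorem topDual_induced_opTopology_weak (j : E →ₗ[ℂ] (H →L[ℂ] K)) :
    topDual ((opTopology .weak).induced j) = Submodule.span ℂ (vectorFuns j) := by
  refine topDual_eq_span_vectorFuns j wotSeminorm ?_ ?_
  · rintro ⟨h, k⟩ g C hC hg
    obtain ⟨k', hk'⟩ := exists_vectorFun_re_eq j g (C := C * ‖k‖) (by positivity) h fun A => by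
      refine (hg A).trans ?_
      rw [mul_assoc]
      refine mul_le_mul_of_nonneg_left ?_ hC
      exact norm_inner_le_norm (𝕜 := ℂ) k (j A h)
    exact ⟨_, Submodule.subset_span (vectorFun_mem j h k'), hk'⟩
  · exact fun h k => ⟨(h, k), 1, fun A => by rw [NNReal.coe_one, one_mul]; exact le_rfl⟩

theorem topDual_induced_opTopology_strong (j : E →ₗ[ℂ] (H →L[ℂ] K)) :
    topDual ((opTopology .strong).induced j) = Submodule.span ℂ (vectorFuns j) := by
  refine topDual_eq_span_vectorFuns j sotSeminorm ?_ ?_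
  · intro h g C hC hg
    obtain ⟨k', hk'⟩ := exists_vectorFun_re_eq j g hC h hg
    exact ⟨_, Submodule.subset_span (vectorFun_mem j h k'), hk'⟩
  · exact fun h k => ⟨h, ‖k‖₊, fun A => norm_inner_le_norm (𝕜 := ℂ) k (A h)⟩

theorem topDual_induced_opTopology_strongStar (j : E →ₗ[ℂ] (H →L[ℂ] K)) :
    topDual ((opTopology .strongStar).induced j) = Submodule.span ℂ (vectorFuns j) := by
  refine topDual_eq_span_vectorFuns j sstarotSeminorm ?_ ?_
  · rintro ⟨h, k⟩ g C hC hg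
    -- The two halves of the S*OT seminorm with C absorbed. The part of g controlled by ‖A h‖ is
    -- represented by a vector of K, the part controlled by ‖A* k‖ by a vector of H.
    let p : Seminorm ℝ E := Seminorm.of (fun A => C * ‖j A h‖)
      (fun A B => by
        rw [← mul_add]
        exact mul_le_mul_of_nonneg_left (by simpa using norm_add_le _ _) hC)
      (fun c A => by
        rw [← Complex.coe_smul, map_smul]
        simp [norm_smul]
        ring)
    let q : Seminorm ℝ E := Seminorm.of (fun A => C * ‖adjoint (j A) k‖)
      (fun A B => by
        rw [← mul_add]
        exact mul_le_mul_of_nonneg_left (by simpa using norm_add_le _ _) hC)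
      (fun c A => by
        rw [← Complex.coe_smul, map_smul, map_smulₛₗ]
        simp [norm_smul]
        ring)
    obtain ⟨g₁, g₂, rfl, h₁, h₂⟩ := exists_add_of_abs_le_add g p q (fun A => by
      refine (hg A).trans (le_of_eq ?_)
      exact mul_add C _ _)
    obtain ⟨k', hk'⟩ := exists_vectorFun_re_eq j g₁ hC h h₁
    obtain ⟨h', hh'⟩ := exists_vectorFun_re_eq_of_adjoint j g₂ hC k h₂
    exact ⟨vectorFun j h k' + vectorFun j h' k, Submodule.add_mem _
      (Submodule.subset_span (vectorFun_mem j h k'))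
      (Submodule.subset_span (vectorFun_mem j h' k)), fun A => by
        rw [LinearMap.add_apply, LinearMap.add_apply, Complex.add_re, hk', hh']⟩
  · refine fun h k => ⟨(h, k), ‖k‖₊, fun A => (norm_inner_le_norm _ _).trans ?_⟩
    refine mul_le_mul_of_nonneg_left ?_ (norm_nonneg k)
    exact le_add_of_nonneg_right (norm_nonneg (adjoint A k))

theorem topDual_induced_opTopology (T : OpTop) (j : E →ₗ[ℂ] (H →L[ℂ] K)) :
    topDual ((opTopology T).induced j) = Submodule.span ℂ (vectorFuns j) := by
  cases T with
  | weak => exact topDual_induced_opTopology_weak j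
  | strong => exact topDual_induced_opTopology_strong j
  | strongStar => exact topDual_induced_opTopology_strongStar j

theorem moduleFilterBasis_topology_induced {F ι : Type*} [AddCommGroup F] [Module ℂ F]
    [Nonempty ι] (q : SeminormFamily ℂ F ι) (r : SeminormFamily ℂ E ι) (j : E →ₗ[ℂ] F)
    (h : ∀ i A, r i A = q i (j A)) :
    r.moduleFilterBasis.topology = q.moduleFilterBasis.topology.induced j := by
  obtain rfl : r = q.comp j := by
    funext i
    ext A
    exact h i A
  let t := q.moduleFilterBasis.topology.induced j
  exact (withSeminorms_induced_moduleFilterBasis q j).topology_eq_withSeminorms.symm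

/-- The σ-seminorms are the ordinary seminorms of the amplified operator, so the σ-duals need no
separate computation. -/
theorem sigmaOpTopology_eq_induced (T : OpTop) :
    sigmaOpTopology T = (opTopology T).induced (amplₗ (H := H) (K := K)) := by
  cases T with
  | weak => exact moduleFilterBasis_topology_induced _ _ _ fun _ _ => rfl
  | strong => exact moduleFilterBasis_topology_induced _ _ _ fun _ _ => rfl
  | strongStar =>
    refine moduleFilterBasis_topology_induced _ _ _ fun p A => ?_
    change ‖ampl A p.1‖ + ‖ampl (adjoint A) p.2‖ = ‖ampl A p.1‖ + ‖adjoint (ampl A) p.2‖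
    rw [adjoint_ampl]

theorem topDual_induced_sigmaOpTopology (T : OpTop) (j : E →ₗ[ℂ] (H →L[ℂ] K)) :
    topDual ((sigmaOpTopology T).induced j) = Submodule.span ℂ (vectorFuns (amplₗ ∘ₗ j)) := by
  rw [sigmaOpTopology_eq_induced, induced_compose]
  exact topDual_induced_opTopology T (amplₗ ∘ₗ j)

end Duals

/-! ### Weak integrals in terms of a spanning set of the dual -/

section Generators

theorem sigmaGenBy_le_iff {X : Type*} {L : Set (X → ℂ)} {m : MeasurableSpace X} :
    sigmaGenBy L ≤ m ↔ ∀ f ∈ L, Measurable[m] f := by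
  simp only [sigmaGenBy, iSup_le_iff, measurable_iff_comap_le]
  rfl

theorem measurable_sigmaGenBy {X : Type*} {L : Set (X → ℂ)} {f : X → ℂ} (hf : f ∈ L) :
    Measurable[sigmaGenBy L] f :=
  sigmaGenBy_le_iff.1 le_rfl f hf

variable {Ω : Type*} [MeasurableSpace Ω]

theorem measurable_sigmaGenBy_iff {X : Type*} {L : Set (X → ℂ)} {f : Ω → X} :
    Measurable[inferInstance, sigmaGenBy L] f ↔ ∀ g ∈ L, Measurable fun ω => g (f ω) := by
  simp only [sigmaGenBy, measurable_iff_comap_le, MeasurableSpace.comap_iSup, iSup_le_iff,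
    MeasurableSpace.comap_comp]
  rfl

variable {E : Type*} [AddCommMonoid E] [Module ℂ E] {t : TopologicalSpace E}
  {G : Set (E →ₗ[ℂ] ℂ)} {ρ : Measure Ω} {f : Ω → E}

theorem measurable_of_mem_span (h : ∀ g ∈ G, Measurable fun ω => g (f ω)) {ℓ : E →ₗ[ℂ] ℂ}
    (hℓ : ℓ ∈ Submodule.span ℂ G) : Measurable fun ω => ℓ (f ω) := by
  induction hℓ using Submodule.span_induction with
  | mem g hg => exact h g hg
  | zero => exact measurable_const
  | add a b _ _ ha hb => exact ha.add hb
  | smul c a _ ha => exact ha.const_smul c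

theorem integrable_of_mem_span (h : ∀ g ∈ G, Integrable (fun ω => g (f ω)) ρ) {ℓ : E →ₗ[ℂ] ℂ}
    (hℓ : ℓ ∈ Submodule.span ℂ G) : Integrable (fun ω => ℓ (f ω)) ρ := by
  induction hℓ using Submodule.span_induction with
  | mem g hg => exact h g hg
  | zero => exact integrable_zero _ _ _
  | add a b _ _ ha hb => exact ha.add hb
  | smul c a _ ha => exact ha.smul c

theorem integral_eq_of_mem_span {S : Set Ω} {v : E}
    (h : ∀ g ∈ G, Integrable (fun ω => g (f ω)) ρ) (hv : ∀ g ∈ G, g v = ∫ ω in S, g (f ω) ∂ρ)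
    {ℓ : E →ₗ[ℂ] ℂ} (hℓ : ℓ ∈ Submodule.span ℂ G) : ℓ v = ∫ ω in S, ℓ (f ω) ∂ρ := by
  induction hℓ using Submodule.span_induction with
  | mem g hg => exact hv g hg
  | zero => simp
  | add a b ha' hb' ha hb =>
    simp only [LinearMap.add_apply]
    rw [ha, hb, integral_add (integrable_of_mem_span h ha').integrableOn
      (integrable_of_mem_span h hb').integrableOn]
  | smul c a _ ha =>
    simp only [LinearMap.smul_apply]
    rw [ha, integral_smul]

theorem sigmaDual_eq_sigmaGenBy (ht : topDual t = Submodule.span ℂ G) :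
    sigmaDual t = sigmaGenBy ((fun g : E →ₗ[ℂ] ℂ => (g : E → ℂ)) '' G) := by
  refine le_antisymm (sigmaGenBy_le_iff.2 ?_) (sigmaGenBy_le_iff.2 ?_)
  · rintro _ ⟨ℓ, hℓ, rfl⟩
    rw [ht] at hℓ
    -- E itself, with the generated σ-algebra, plays the role of the measure space, and the map is
    -- the identity.
    refine @measurable_of_mem_span E (sigmaGenBy _) E _ _ G id (fun g hg => ?_) ℓ hℓ
    exact measurable_sigmaGenBy ⟨g, hg, rfl⟩
  · rintro _ ⟨g, hg, rfl⟩
    exact measurable_sigmaGenBy ⟨g, by rw [ht]; exact Submodule.subset_span hg, rfl⟩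

theorem weaklyMeasurable_iff (ht : topDual t = Submodule.span ℂ G) :
    WeaklyMeasurable t f ↔ ∀ g ∈ G, Measurable fun ω => g (f ω) := by
  rw [WeaklyMeasurable, measurable_sigmaGenBy_iff]
  constructor
  · exact fun h g hg => h g ⟨g, by rw [ht]; exact Submodule.subset_span hg, rfl⟩
  · rintro h _ ⟨ℓ, hℓ, rfl⟩
    rw [ht] at hℓ
    exact measurable_of_mem_span h hℓ

theorem integrable_of_lintegral_lt_top {g : Ω → ℂ} (hg : Measurable g)
    (h : ∫⁻ ω, ‖g ω‖ₑ ∂ρ < ∞) : Integrable g ρ :=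
  ⟨hg.aestronglyMeasurable, h⟩

theorem isWeakIntegral_iff (ht : topDual t = Submodule.span ℂ G)
    (hi : ∀ g ∈ G, Integrable (fun ω => g (f ω)) ρ) {S : Set Ω} {v : E} :
    IsWeakIntegral t ρ f S v ↔ ∀ g ∈ G, g v = ∫ ω in S, g (f ω) ∂ρ := by
  constructor
  · exact fun h g hg => h g (by rw [ht]; exact Submodule.subset_span hg)
  · intro h ℓ hℓ
    rw [ht] at hℓ
    exact integral_eq_of_mem_span hi h hℓ

theorem WeaklyIntegrable.integrable (h : WeaklyIntegrable t ρ f) {ℓ : E →ₗ[ℂ] ℂ}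
    (hℓ : ℓ ∈ topDual t) : Integrable (fun ω => ℓ (f ω)) ρ :=
  integrable_of_lintegral_lt_top
    (measurable_sigmaGenBy_iff.1 h.weaklyMeasurable ℓ ⟨ℓ, hℓ, rfl⟩) (h.lintegral_lt_top ℓ hℓ)

/-- The dual may be replaced by a spanning set, since measurability, integrability and the integral
identity all pass to linear combinations. -/
theorem weaklyIntegrable_iff (ht : topDual t = Submodule.span ℂ G) :
    WeaklyIntegrable t ρ f ↔ (∀ g ∈ G, Measurable fun ω => g (f ω)) ∧
      (∀ g ∈ G, ∫⁻ ω, ‖g (f ω)‖ₑ ∂ρ < ∞) ∧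
      ∀ S, MeasurableSet S → ∃ v, ∀ g ∈ G, g v = ∫ ω in S, g (f ω) ∂ρ := by
  constructor
  · intro h
    have hG : ∀ g ∈ G, g ∈ topDual t := fun g hg => by rw [ht]; exact Submodule.subset_span hg
    refine ⟨(weaklyMeasurable_iff ht).1 h.weaklyMeasurable,
      fun g hg => h.lintegral_lt_top g (hG g hg), fun S hS => ?_⟩
    obtain ⟨v, hv⟩ := h.exists_integral S hS
    exact ⟨v, fun g hg => hv g (hG g hg)⟩
  · rintro ⟨h₁, h₂, h₃⟩
    have hi : ∀ g ∈ G, Integrable (fun ω => g (f ω)) ρ := fun g hg =>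
      integrable_of_lintegral_lt_top (h₁ g hg) (h₂ g hg)
    refine ⟨(weaklyMeasurable_iff ht).2 h₁, fun ℓ hℓ => ?_, fun S hS => ?_⟩
    · rw [ht] at hℓ
      exact (integrable_of_mem_span hi hℓ).hasFiniteIntegral
    · obtain ⟨v, hv⟩ := h₃ S hS
      exact ⟨v, (isWeakIntegral_iff ht hi).2 hv⟩

end Generators

/-! ### Measurability -/

section Measurability

variable {X : Type*} [MeasurableSpace X]

open ContinuousLinearMap (adjoint)

variable {H K : Type*} [NormedAddCommGroup H] [InnerProductSpace ℂ H] [CompleteSpace H]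
  [NormedAddCommGroup K] [InnerProductSpace ℂ K] [CompleteSpace K]

theorem PointwiseWeaklyMeasurable.ampl {F : X → H →L[ℂ] K} (hF : PointwiseWeaklyMeasurable F)
    (h : ell2 H) (k : ell2 K) : Measurable fun x => inner ℂ k (ampl (F x) h) := by
  simp only [lp.inner_eq_tsum]
  exact Measurable.tsum fun n => hF (h n) (k n)

/-- The basis of K may be uncountable, while measurability survives countable sums only. Finiteness
of ∑⟨|B|e, e⟩ leaves countably many nonzero terms, and ⟨|B|e, e⟩ = 0 forces |B|^{1/2} e = 0, hence
B*B e = 0 and B e = 0. -/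
theorem countable_setOf_apply_onb_ne_zero {B : K →L[ℂ] H} (hB : B ∈ traceClass K H) :
    {e : onbSet K | B (onb K e) ≠ 0}.Countable := by
  have hB' : schattenOneNorm B ≠ ∞ := ne_of_lt hB
  refine (Summable.countable_support_ennreal hB').mono fun e he => ?_
  rw [Function.mem_support]
  intro h0
  apply he
  set P := CFC.sqrt (adjoint B ∘L B) with hP
  have hBB : 0 ≤ adjoint B ∘L B :=
    (ContinuousLinearMap.nonneg_iff_isPositive _).2 (ContinuousLinearMap.isPositive_adjoint_comp_self B)
  have hP0 : 0 ≤ P := CFC.sqrt_nonneg _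
  have hPP : P * P = adjoint B ∘L B := CFC.sqrt_mul_sqrt_self _ hBB
  set Q := CFC.sqrt P
  have hQ : Q * Q = P := CFC.sqrt_mul_sqrt_self _ hP0
  have hQs : adjoint Q = Q := (CFC.sqrt_nonneg P).isSelfAdjoint
  have h1 : (inner ℂ (onb K e) (P (onb K e))).re = ‖Q (onb K e)‖ ^ 2 := by
    rw [← hQ, mul_apply_eq_comp, ← ContinuousLinearMap.adjoint_inner_left, hQs,
      inner_self_eq_norm_sq_to_K]
    norm_cast
  have h2 : ‖Q (onb K e)‖ ^ 2 ≤ 0 := by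
    rw [← h1]
    exact ENNReal.ofReal_eq_zero.1 h0
  have h3 : Q (onb K e) = 0 := by
    rw [← norm_le_zero_iff]
    nlinarith [norm_nonneg (Q (onb K e))]
  have h4 : (adjoint B ∘L B) (onb K e) = 0 := by
    rw [← hPP, ← hQ]
    simp [h3]
  have h5 : inner ℂ (B (onb K e)) (B (onb K e)) = (0 : ℂ) := by
    rw [← ContinuousLinearMap.adjoint_inner_right]
    simpa using congrArg (inner ℂ (onb K e)) h4
  exact inner_self_eq_zero.1 h5

theorem PointwiseWeaklyMeasurable.trace {F : X → H →L[ℂ] K} (hF : PointwiseWeaklyMeasurable F)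
    {B : K →L[ℂ] H} (hB : B ∈ traceClass K H) : Measurable fun x => trace (F x ∘L B) := by
  have hc := countable_setOf_apply_onb_ne_zero hB
  have := hc.to_subtype
  have heq : ∀ x, WeakInt.trace (F x ∘L B) =
      ∑' e : {e : onbSet K | B (onb K e) ≠ 0}, inner ℂ (onb K e) (F x (B (onb K e))) := fun x => by
    refine (tsum_subtype_eq_of_support_subset
      (f := fun e => inner ℂ (onb K e) (F x (B (onb K e)))) ?_).symm
    intro e he h0
    exact he (by simp [h0])
  simp only [heq]
  exact Measurable.tsum fun e => hF _ _

/-- The rank one operator `x ↦ ⟨x, k⟩ h` is of trace class. -/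
theorem rankOne_mem_traceClass (h : H) (k : K) :
    InnerProductSpace.rankOne ℂ h k ∈ traceClass K H := by
  set B := InnerProductSpace.rankOne ℂ h k with hB
  -- The scalar for which |B| = c ⟨·, k⟩ k. For k = 0 the division yields c = 0, consistent with B =
  -- 0.
  set c : ℝ := ‖h‖ / ‖k‖ with hc
  have hc0 : 0 ≤ c := by positivity
  have hsq : CFC.sqrt (adjoint B ∘L B) = (c : ℂ) • InnerProductSpace.rankOne ℂ k k := by
    refine CFC.sqrt_unique ?_ ?_
    · ext x
      by_cases hk : k = 0
      · subst hk
        simp [hB]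
      · have hk' : (‖k‖ : ℂ) ≠ 0 := by simpa using hk
        simp [hB, hc, inner_self_eq_norm_sq_to_K, smul_smul]
        congr 1
        field_simp
    · rw [ContinuousLinearMap.nonneg_iff_isPositive]
      refine ContinuousLinearMap.IsPositive.smul_of_nonneg ?_ (by exact_mod_cast hc0)
      exact InnerProductSpace.isPositive_rankOne_self k
  change schattenOneNorm B < ∞
  have hs : Summable fun e : onbSet K => c * (inner ℂ k (onb K e) * inner ℂ (onb K e) k : ℂ).re :=
    (Complex.hasSum_re ((onb K).summable_inner_mul_inner k k).hasSum).summable.mul_left c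
  rw [schattenOneNorm, hsq]
  refine lt_of_le_of_lt (le_of_eq ?_) (lt_top_iff_ne_top.2 hs.tsum_ofReal_ne_top)
  refine tsum_congr fun e => ?_
  congr 1
  simp

theorem trace_comp_rankOne (A : H →L[ℂ] K) (h : H) (k : K) :
    WeakInt.trace (A ∘L InnerProductSpace.rankOne ℂ h k) = inner ℂ k (A h) := by
  rw [← (onb K).tsum_inner_mul_inner k (A h), WeakInt.trace]
  exact tsum_congr fun e => by simp

theorem vectorFuns_image_coe (V : Submodule ℂ (H →L[ℂ] K)) :
    (fun g : V →ₗ[ℂ] ℂ => (g : V → ℂ)) '' vectorFuns V.subtype =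
      {f : V → ℂ | ∃ (h : H) (k : K), f = fun A : V => inner ℂ k ((A : H →L[ℂ] K) h)} := by
  ext f
  constructor
  · rintro ⟨_, ⟨⟨h, k⟩, rfl⟩, rfl⟩
    exact ⟨h, k, rfl⟩
  · rintro ⟨h, k, rfl⟩
    exact ⟨_, vectorFun_mem V.subtype h k, rfl⟩

theorem pointwiseWeaklyMeasurable_coe (V : Submodule ℂ (H →L[ℂ] K)) :
    let _ := sigmaPointwise V
    PointwiseWeaklyMeasurable (Ω := V) (fun A : V => (A : H →L[ℂ] K)) :=
  fun h k => measurable_sigmaGenBy ⟨h, k, rfl⟩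

theorem topDual_opTopologyOn (T : OpTop) (V : Submodule ℂ (H →L[ℂ] K)) :
    topDual (opTopologyOn T V) = Submodule.span ℂ (vectorFuns V.subtype) :=
  topDual_induced_opTopology T V.subtype

theorem topDual_sigmaOpTopologyOn (T : OpTop) (V : Submodule ℂ (H →L[ℂ] K)) :
    topDual (sigmaOpTopologyOn T V) = Submodule.span ℂ (vectorFuns (amplₗ ∘ₗ V.subtype)) :=
  topDual_induced_sigmaOpTopology T V.subtype

theorem sigmaDual_opTopologyOn (T : OpTop) (V : Submodule ℂ (H →L[ℂ] K)) :
    sigmaDual (opTopologyOn T V) = sigmaPointwise V := by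
  rw [sigmaDual_eq_sigmaGenBy (topDual_opTopologyOn T V), vectorFuns_image_coe]

/-- Rank one operators B recover the vector functionals; conversely each trace is a countable sum of
vector functionals, measurable on V regarded as the measure space. -/
theorem sigmaTrace_eq_sigmaPointwise (V : Submodule ℂ (H →L[ℂ] K)) :
    sigmaTrace V = sigmaPointwise V := by
  refine le_antisymm (sigmaGenBy_le_iff.2 ?_) (sigmaGenBy_le_iff.2 ?_)
  · rintro _ ⟨B, hB, rfl⟩
    exact @PointwiseWeaklyMeasurable.trace V (sigmaPointwise V) H K _ _ _ _ _ _ _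
      (pointwiseWeaklyMeasurable_coe V) B hB
  · rintro _ ⟨h, k, rfl⟩
    exact measurable_sigmaGenBy ⟨_, rankOne_mem_traceClass h k, by simp only [trace_comp_rankOne]⟩

/-- Sequences supported at index 0 show that the 𝒯-dual is contained in the σ-𝒯-dual. -/
theorem vectorFun_ell2_single (V : Submodule ℂ (H →L[ℂ] K)) (h : H) (k : K) :
    vectorFun (amplₗ ∘ₗ V.subtype) (lp.single 2 0 h) (lp.single 2 0 k) =
      vectorFun V.subtype h k := by
  ext A
  simp only [vectorFun_apply, LinearMap.comp_apply, amplₗ_apply, Submodule.subtype_apply]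
  rw [lp.inner_single_left, ampl_apply, lp.single_apply_self]

theorem sigmaDual_sigmaOpTopologyOn (T : OpTop) (V : Submodule ℂ (H →L[ℂ] K)) :
    sigmaDual (sigmaOpTopologyOn T V) = sigmaPointwise V := by
  rw [sigmaDual_eq_sigmaGenBy (topDual_sigmaOpTopologyOn T V)]
  refine le_antisymm (sigmaGenBy_le_iff.2 ?_) (sigmaGenBy_le_iff.2 ?_)
  · rintro _ ⟨_, ⟨⟨h, k⟩, rfl⟩, rfl⟩
    exact @PointwiseWeaklyMeasurable.ampl V (sigmaPointwise V) H K _ _ _ _ _ _ _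
      (pointwiseWeaklyMeasurable_coe V) h k
  · rintro _ ⟨h, k, rfl⟩
    refine measurable_sigmaGenBy ⟨_, vectorFun_mem _ (lp.single 2 0 h) (lp.single 2 0 k), ?_⟩
    dsimp only
    rw [vectorFun_ell2_single]
    rfl

theorem measurable_sigmaPointwise_iff (V : Submodule ℂ (H →L[ℂ] K)) {F : X → V} :
    Measurable[inferInstance, sigmaPointwise V] F ↔
      PointwiseWeaklyMeasurable fun x => (F x : H →L[ℂ] K) := by
  rw [measurable_sigmaGenBy_iff]
  constructor
  · exact fun h a b => h _ ⟨a, b, rfl⟩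
  · rintro h _ ⟨a, b, rfl⟩
    exact h a b

end Measurability

section PointwiseIntegrals

variable {Ω : Type*} [MeasurableSpace Ω] {ρ : Measure Ω}
variable {H K : Type*} [NormedAddCommGroup H] [InnerProductSpace ℂ H] [CompleteSpace H]
  [NormedAddCommGroup K] [InnerProductSpace ℂ K] [CompleteSpace K]

/-! ### Pointwise Pettis integrals and weak integrals in the operator topologies -/

theorem isPointwisePettisIntegral_iff {F : Ω → H →L[ℂ] K} {S : Set Ω} {A : H →L[ℂ] K} :
    IsPointwisePettisIntegral ρ F S A ↔
      ∀ h k, inner ℂ k (A h) = ∫ ω in S, inner ℂ k (F ω h) ∂ρ := by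
  refine forall_congr' fun h => ⟨fun H' k => ?_, fun H' ℓ hℓ => ?_⟩
  · exact H' (innerₛₗ ℂ k) (innerSL ℂ k).continuous
  · have hr : ∀ x, ℓ x = inner ℂ ((InnerProductSpace.toDual ℂ K).symm ⟨ℓ, hℓ⟩) x := fun x =>
      (InnerProductSpace.toDual_symm_apply (𝕜 := ℂ) (y := (⟨ℓ, hℓ⟩ : StrongDual ℂ K))).symm
    simp only [hr]
    exact H' _

theorem eq_of_forall_inner_apply {A B : H →L[ℂ] K}
    (h : ∀ x y, (inner ℂ y (A x) : ℂ) = inner ℂ y (B x)) : A = B := by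
  ext x
  exact ext_inner_left ℂ fun y => h x y

theorem isPointwisePettisIntegral_iff_eq {F : Ω → H →L[ℂ] K} {S : Set Ω} {A : H →L[ℂ] K}
    (hA : ∀ h k, inner ℂ k (A h) = ∫ ω in S, inner ℂ k (F ω h) ∂ρ) (B : H →L[ℂ] K) :
    IsPointwisePettisIntegral ρ F S B ↔ B = A := by
  rw [isPointwisePettisIntegral_iff]
  constructor
  · exact fun hB => eq_of_forall_inner_apply fun x y => (hB x y).trans (hA x y).symm
  · rintro rfl
    exact hA

theorem pointwisePettisIntegrableIn_iff (V : Submodule ℂ (H →L[ℂ] K)) (F : Ω → V) (T : OpTop) :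
    PointwisePettisIntegrableIn V ρ F ↔ WeaklyIntegrable (opTopologyOn T V) ρ F := by
  rw [weaklyIntegrable_iff (topDual_opTopologyOn T V)]
  constructor
  · rintro ⟨⟨h₁, h₂⟩, h₃⟩
    refine ⟨?_, ?_, fun S hS => ?_⟩
    · rintro _ ⟨⟨h, k⟩, rfl⟩
      exact h₁ h k
    · rintro _ ⟨⟨h, k⟩, rfl⟩
      exact h₂ h k
    · obtain ⟨A, hA, hi⟩ := h₃ S hS
      refine ⟨⟨A, hA⟩, ?_⟩
      rintro _ ⟨⟨h, k⟩, rfl⟩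
      exact isPointwisePettisIntegral_iff.1 hi h k
  · rintro ⟨h₁, h₂, h₃⟩
    refine ⟨⟨fun h k => h₁ _ (vectorFun_mem _ h k), fun h k => h₂ _ (vectorFun_mem _ h k)⟩,
      fun S hS => ?_⟩
    obtain ⟨v, hv⟩ := h₃ S hS
    exact ⟨v, v.2, isPointwisePettisIntegral_iff.2 fun h k => hv _ (vectorFun_mem _ h k)⟩

theorem IsWeakIntegral.inner_eq {V : Submodule ℂ (H →L[ℂ] K)} {F : Ω → V} {T : OpTop} {S : Set Ω}
    {A : V} (hA : IsWeakIntegral (opTopologyOn T V) ρ F S A) (h : H) (k : K) :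
    inner ℂ k ((A : H →L[ℂ] K) h) = ∫ ω in S, inner ℂ k ((F ω : H →L[ℂ] K) h) ∂ρ :=
  hA (vectorFun V.subtype h k) (by
    rw [topDual_opTopologyOn]
    exact Submodule.subset_span (vectorFun_mem _ h k))

theorem isWeakIntegral_iff_eq {E : Type*} [AddCommMonoid E] [Module ℂ E] {t : TopologicalSpace E}
    {f : Ω → E} {S : Set Ω} {v : E} (hv : IsWeakIntegral t ρ f S v)
    (hsep : ∀ w, (∀ ℓ ∈ topDual t, ℓ w = ℓ v) → w = v) (w : E) :
    IsWeakIntegral t ρ f S w ↔ w = v := by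
  constructor
  · exact fun hw => hsep w fun ℓ hℓ => (hw ℓ hℓ).trans (hv ℓ hℓ).symm
  · rintro rfl
    exact hv

theorem eq_of_topDual_opTopologyOn {V : Submodule ℂ (H →L[ℂ] K)} {T : OpTop} {A B : V}
    (h : ∀ ℓ ∈ topDual (opTopologyOn T V), ℓ B = ℓ A) : B = A :=
  Subtype.ext <| eq_of_forall_inner_apply fun x y => h (vectorFun V.subtype x y) (by
    rw [topDual_opTopologyOn]
    exact Submodule.subset_span (vectorFun_mem _ x y))

theorem vectorFun_mem_topDual_sigmaOpTopologyOn (V : Submodule ℂ (H →L[ℂ] K)) (T : OpTop)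
    (h : ell2 H) (k : ell2 K) :
    vectorFun (amplₗ ∘ₗ V.subtype) h k ∈ topDual (sigmaOpTopologyOn T V) := by
  rw [topDual_sigmaOpTopologyOn]
  exact Submodule.subset_span (vectorFun_mem _ h k)

theorem eq_of_topDual_sigmaOpTopologyOn {V : Submodule ℂ (H →L[ℂ] K)} {T : OpTop} {A B : V}
    (h : ∀ ℓ ∈ topDual (sigmaOpTopologyOn T V), ℓ B = ℓ A) : B = A :=
  Subtype.ext <| eq_of_forall_inner_apply fun x y => by
    have := h _ (vectorFun_mem_topDual_sigmaOpTopologyOn V T (lp.single 2 0 x) (lp.single 2 0 y))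
    rwa [vectorFun_ell2_single] at this

/-- The triangle inequality for operator-valued weak integrals. -/
theorem enorm_le_lowerIntegral {F : Ω → H →L[ℂ] K} (hF : PointwiseWeaklyMeasurable F)
    {A : H →L[ℂ] K} (hA : ∀ h k, inner ℂ k (A h) = ∫ ω, inner ℂ k (F ω h) ∂ρ) :
    ‖A‖ₑ ≤ lowerIntegral ρ fun ω => ‖F ω‖ₑ := by
  set I := lowerIntegral ρ fun ω => ‖F ω‖ₑ with hI
  rcases eq_or_ne I ∞ with h | hfin
  · rw [h]; exact le_top
  have key : ∀ (h : H) (k : K), ‖h‖ ≤ 1 → ‖k‖ ≤ 1 → ‖(inner ℂ k (A h) : ℂ)‖ ≤ I.toReal := by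
    intro h k hh hk
    rw [← ENNReal.ofReal_le_iff_le_toReal hfin, ofReal_norm, hA]
    refine (enorm_integral_le_lintegral_enorm _).trans ?_
    -- This scalar function is measurable and, as h and k lie in the unit ball, bounded by ‖F‖, so
    -- it competes in the lower integral; ‖F‖ itself need not be measurable.
    refine le_iSup_of_le (fun ω => ‖(inner ℂ k (F ω h) : ℂ)‖ₑ) (le_iSup_of_le (hF h k).enorm
      (le_iSup_of_le (Filter.Eventually.of_forall fun ω => ?_) le_rfl))
    dsimp only
    rw [← ofReal_norm, ← ofReal_norm]
    refine ENNReal.ofReal_le_ofReal ((norm_inner_le_norm _ _).trans ?_)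
    have h1 : ‖F ω h‖ ≤ ‖F ω‖ := (F ω).unit_le_opNorm h hh
    nlinarith [norm_nonneg k, norm_nonneg (F ω h), norm_nonneg (F ω)]
  rw [← ofReal_norm, ENNReal.ofReal_le_iff_le_toReal hfin]
  refine ContinuousLinearMap.opNorm_le_of_unit_norm ENNReal.toReal_nonneg fun {h} hh => ?_
  rcases eq_or_ne (A h) 0 with h0 | h0
  · rw [h0, norm_zero]; exact ENNReal.toReal_nonneg
  have h0' : ‖A h‖ ≠ 0 := norm_ne_zero_iff.2 h0
  -- For the unit vector k = A h / ‖A h‖ the inner product equals ‖A h‖.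
  have := key h (((‖A h‖⁻¹ : ℝ) : ℂ) • A h) hh.le (by simp [norm_smul, h0'])
  rw [inner_smul_left, inner_self_eq_norm_sq_to_K, norm_mul] at this
  simp at this
  rw [sq, inv_mul_cancel_left₀ h0'] at this
  exact this

/-! ### Existence of integrals by the closed graph theorem -/

/-- Closed graph theorem for x ↦ g(·)x into L¹: an L¹-convergent sequence has an a.e. convergent
subsequence, whose limit is forced by continuity of each g ω. -/
theorem continuous_setIntegral_apply {X : Type*} [NormedAddCommGroup X] [NormedSpace ℂ X]
    [CompleteSpace X] {g : Ω → StrongDual ℂ X} (hg : ∀ x, Integrable (fun ω => g ω x) ρ)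
    (S : Set Ω) : Continuous fun x => ∫ ω in S, g ω x ∂ρ := by
  let Λ : X →ₗ[ℂ] (Ω →₁[ρ] ℂ) :=
    { toFun := fun x => (hg x).toL1 _
      map_add' := fun x y => by
        rw [← Integrable.toL1_add]
        exact Integrable.toL1_eq_toL1_iff _ _ _ _ |>.2 (.of_forall fun ω => by simp)
      map_smul' := fun c x => by
        rw [RingHom.id_apply, ← Integrable.toL1_smul]
        exact Integrable.toL1_eq_toL1_iff _ _ _ _ |>.2 (.of_forall fun ω => by simp) }
  have hΛ : Continuous Λ := by
    refine LinearMap.continuous_of_seq_closed_graph Λ fun u x z hu hz => ?_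
    obtain ⟨n, hn, hae⟩ := (tendstoInMeasure_of_tendsto_Lp hz).exists_seq_tendsto_ae
    have hall : ∀ᵐ ω ∂ρ, ∀ i, (Λ (u i) : Ω → ℂ) ω = g ω (u i) :=
      ae_all_iff.2 fun i => (hg (u i)).coeFn_toL1
    refine Lp.ext ?_
    filter_upwards [hae, hall, (hg x).coeFn_toL1] with ω h₁ h₂ h₃
    refine tendsto_nhds_unique h₁ ?_
    change _ = g ω x at h₃
    change Filter.Tendsto _ _ (𝓝 (((hg x).toL1 _ : Ω → ℂ) ω))
    rw [h₃]
    simp only [Function.comp_apply, h₂]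
    exact ((g ω).continuous.tendsto x).comp (hu.comp hn.tendsto_atTop)
  have heq : (fun x => ∫ ω in S, g ω x ∂ρ) = fun x => ∫ ω in S, (Λ x : Ω → ℂ) ω ∂ρ := by
    funext x
    exact integral_congr_ae (ae_restrict_of_ae ((hg x).coeFn_toL1.mono fun _ h => h.symm))
  rw [heq]
  exact (continuous_setIntegral S).comp hΛ

/-- For fixed h the integral is continuous in k, so Riesz yields the vector a h. The map h ↦ a h is
weakly continuous, hence bounded by the closed graph theorem. -/
theorem exists_forall_inner_eq_setIntegral {F : Ω → H →L[ℂ] K}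
    (hF : ∀ h k, Integrable (fun ω => (inner ℂ k (F ω h) : ℂ)) ρ) (S : Set Ω) :
    ∃ A : H →L[ℂ] K, ∀ h k, inner ℂ k (A h) = ∫ ω in S, inner ℂ k (F ω h) ∂ρ := by
  -- The conjugate pairing is linear in k, as Riesz requires.
  have hF' : ∀ h k, Integrable (fun ω => (inner ℂ (F ω h) k : ℂ)) ρ := fun h k => by
    simpa using! Complex.conjCLE.toContinuousLinearMap.integrable_comp (hF h k)
  have hc : ∀ h, Continuous fun k => ∫ ω in S, (inner ℂ (F ω h) k : ℂ) ∂ρ := fun h =>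
    continuous_setIntegral_apply (g := fun ω => innerSL ℂ (F ω h)) (hF' h) S
  let φ : H → StrongDual ℂ K := fun h =>
    { toFun := fun k => ∫ ω in S, (inner ℂ (F ω h) k : ℂ) ∂ρ
      map_add' := fun k l => by
        simp only [inner_add_right]
        exact integral_add (hF' h k).integrableOn (hF' h l).integrableOn
      map_smul' := fun c k => by
        simp only [inner_smul_right, RingHom.id_apply, smul_eq_mul]
        exact integral_const_mul _ _
      cont := hc h }
  let a : H → K := fun h => (InnerProductSpace.toDual ℂ K).symm (φ h)
  have ha : ∀ h k, inner ℂ k (a h) = ∫ ω in S, (inner ℂ k (F ω h) : ℂ) ∂ρ := fun h k => by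
    rw [← inner_conj_symm, InnerProductSpace.toDual_symm_apply]
    change (starRingEnd ℂ) (∫ ω in S, (inner ℂ (F ω h) k : ℂ) ∂ρ) = _
    rw [← integral_conj]
    simp only [inner_conj_symm]
  let A : H →ₗ[ℂ] K :=
    { toFun := a
      map_add' := fun x y => ext_inner_left ℂ fun k => by
        rw [inner_add_right, ha, ha, ha, ← integral_add (hF x k).integrableOn
          (hF y k).integrableOn]
        simp only [map_add, inner_add_right]
      map_smul' := fun c x => ext_inner_left ℂ fun k => by
        rw [RingHom.id_apply, inner_smul_right, ha, ha, ← integral_const_mul]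
        simp only [map_smul, inner_smul_right] }
  refine ⟨⟨A, LinearMap.continuous_of_seq_closed_graph A fun u x z hu hz => ?_⟩, ha⟩
  refine ext_inner_left ℂ fun k => ?_
  have h1 : Filter.Tendsto (fun n => (inner ℂ k (A (u n)) : ℂ)) Filter.atTop (𝓝 (inner ℂ k z)) :=
    ((innerSL ℂ k).continuous.tendsto z).comp hz
  have h2 : Continuous fun x => (inner ℂ k (A x) : ℂ) := by
    have : (fun x => (inner ℂ k (A x) : ℂ)) = fun x => ∫ ω in S, (inner ℂ k (F ω x) : ℂ) ∂ρ :=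
      funext fun x => ha x k
    rw [this]
    exact continuous_setIntegral_apply (g := fun ω => (innerSL ℂ k).comp (F ω))
      (fun x => hF x k) S
  exact tendsto_nhds_unique h1 ((h2.tendsto x).comp hu)

theorem inner_ampl_single (A : H →L[ℂ] K) (m n : ℕ) (h : H) (k : K) :
    (inner ℂ (lp.single 2 m k : ell2 K) (ampl A (lp.single 2 n h)) : ℂ) =
      if m = n then inner ℂ k (A h) else 0 := by
  rw [lp.inner_single_left, ampl_apply]
  split_ifs with hmn
  · subst hmn
    rw [lp.single_apply_self]
  · rw [lp.single_apply_ne _ _ _ hmn, map_zero, inner_zero_right]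

/-- The amplified family has an integral on ℓ². Its matrix entries vanish off the diagonal and all
equal the integral of F on it, so it is itself an amplification. -/
theorem exists_forall_inner_ampl_eq_setIntegral {F : Ω → H →L[ℂ] K}
    (hF : ∀ (h : ell2 H) (k : ell2 K), Integrable (fun ω => (inner ℂ k (ampl (F ω) h) : ℂ)) ρ)
    (S : Set Ω) :
    ∃ A : H →L[ℂ] K, ∀ (h : ell2 H) (k : ell2 K),
      inner ℂ k (ampl A h) = ∫ ω in S, inner ℂ k (ampl (F ω) h) ∂ρ := by
  obtain ⟨B, hB⟩ := exists_forall_inner_eq_setIntegral hF S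
  obtain ⟨A, hA⟩ := exists_forall_inner_eq_setIntegral (F := F) (fun h k => by
    simpa only [inner_ampl_single, if_true] using hF (lp.single 2 0 h) (lp.single 2 0 k)) S
  have hAB : B = ampl A := by
    refine lp.ext_continuousLinearMap (ENNReal.ofNat_ne_top (n := nat_lit 2)) fun n => ?_
    ext h m
    refine ext_inner_left ℂ fun k => ?_
    have h1 : ∀ C : ell2 H →L[ℂ] ell2 K, (inner ℂ k ((C (lp.single 2 n h)) m) : ℂ) =
        inner ℂ (lp.single 2 m k : ell2 K) (C (lp.single 2 n h)) := fun C => by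
      rw [lp.inner_single_left]
    change inner ℂ k ((B (lp.single 2 n h)) m) = inner ℂ k ((ampl A (lp.single 2 n h)) m)
    rw [h1, h1, hB]
    simp only [inner_ampl_single]
    split_ifs with hmn
    · exact (hA h k).symm
    · simp
  exact ⟨A, fun h k => by rw [← hAB, hB]⟩

end PointwiseIntegrals

/-! ### σ-weakly closed spaces and weak* integrals -/

section SigmaClosed

theorem exists_topDual_ne_zero {E ι : Type*} [AddCommGroup E] [Module ℂ E] [Nonempty ι]
    (q : SeminormFamily ℂ E ι) (V : Submodule ℂ E)
    (hV : IsClosed[q.moduleFilterBasis.topology] (V : Set E)) {x : E} (hx : x ∉ V) :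
    ∃ ℓ ∈ topDual q.moduleFilterBasis.topology, (∀ v ∈ V, ℓ v = 0) ∧ ℓ x ≠ 0 := by
  let _ := q.moduleFilterBasis.topology
  have hq : WithSeminorms q := ⟨rfl⟩
  have := hq.topologicalAddGroup
  have := hq.continuousSMul
  let _ : Module ℝ E := Module.complexToReal E
  have : LocallyConvexSpace ℝ E := hq.toLocallyConvexSpace
  obtain ⟨f, u, hu, hfx⟩ := RCLike.geometric_hahn_banach_closed_point (𝕜 := ℂ)
    ((V.restrictScalars ℝ).convex) hV hx
  have hu0 : 0 < u := by simpa using hu 0 V.zero_mem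
  have hre : ∀ v ∈ V, RCLike.re (f v) = 0 := by
    intro v hv
    by_contra hne
    -- At this multiple of v the real part of f equals u, contradicting the strict bound on V.
    have := hu (((u / RCLike.re (f v) : ℝ) : ℂ) • v) (V.smul_mem _ hv)
    simp only [map_smul, smul_eq_mul, RCLike.re_to_complex, Complex.re_ofReal_mul] at this hne
    rw [div_mul_cancel₀ _ hne] at this
    exact lt_irrefl _ this
  refine ⟨f, f.continuous, fun v hv => Complex.ext (hre v hv) ?_, fun h0 => ?_⟩
  · have := hre (Complex.I • v) (V.smul_mem _ hv)
    simpa using this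
  · have h0' : f x = 0 := h0
    rw [h0'] at hfx
    simp at hfx
    exact absurd hfx hu0.not_gt

variable {Ω : Type*} [MeasurableSpace Ω] {ρ : Measure Ω}
variable {H K : Type*} [NormedAddCommGroup H] [InnerProductSpace ℂ H] [CompleteSpace H]
  [NormedAddCommGroup K] [InnerProductSpace ℂ K] [CompleteSpace K]

/-- A σ-weakly continuous functional vanishing on V vanishes on every F ω, hence on the integral A;
by Hahn–Banach no such functional can separate A from V. -/
theorem mem_of_forall_inner_ampl_eq_setIntegral {V : Submodule ℂ (H →L[ℂ] K)}
    (hV : IsClosed[sigmaOpTopology .weak] (V : Set (H →L[ℂ] K))) {F : Ω → V}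
    (hF : ∀ (h : ell2 H) (k : ell2 K),
      Integrable (fun ω => (inner ℂ k (ampl (F ω : H →L[ℂ] K) h) : ℂ)) ρ)
    {S : Set Ω} {A : H →L[ℂ] K}
    (hA : ∀ (h : ell2 H) (k : ell2 K),
      inner ℂ k (ampl A h) = ∫ ω in S, inner ℂ k (ampl (F ω : H →L[ℂ] K) h) ∂ρ) : A ∈ V := by
  by_contra hAV
  obtain ⟨ℓ, hℓ, h0, hne⟩ := exists_topDual_ne_zero _ V hV hAV
  have hd : ℓ ∈ Submodule.span ℂ (vectorFuns (amplₗ ∘ₗ (LinearMap.id : (H →L[ℂ] K) →ₗ[ℂ] _))) := by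
    rw [← SetLike.mem_coe, ← topDual_induced_sigmaOpTopology .weak, LinearMap.id_coe,
      @induced_id _ (sigmaOpTopology .weak)]
    exact hℓ
  apply hne
  rw [integral_eq_of_mem_span (f := fun ω => (F ω : H →L[ℂ] K)) (ρ := ρ) (S := S) (v := A) ?_ ?_ hd]
  · simp [h0]
  · rintro _ ⟨⟨h, k⟩, rfl⟩
    exact hF h k
  · rintro _ ⟨⟨h, k⟩, rfl⟩
    exact hA h k

/-- Closedness makes the existence of integrals automatic, so only measurability and absolute
integrability remain. -/
theorem weaklyIntegrable_sigmaOpTopologyOn_iff {V : Submodule ℂ (H →L[ℂ] K)}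
    (hV : IsClosed[sigmaOpTopology .weak] (V : Set (H →L[ℂ] K))) (F : Ω → V) (T : OpTop) :
    WeaklyIntegrable (sigmaOpTopologyOn T V) ρ F ↔
      PointwiseWeaklyMeasurable (fun ω => (F ω : H →L[ℂ] K)) ∧
        ∀ (h : ell2 H) (k : ell2 K),
          ∫⁻ ω, ‖inner ℂ k (ampl (F ω : H →L[ℂ] K) h)‖ₑ ∂ρ < ∞ := by
  rw [weaklyIntegrable_iff (topDual_sigmaOpTopologyOn T V)]
  constructor
  · rintro ⟨h₁, h₂, -⟩
    refine ⟨fun h k => ?_, fun h k => h₂ _ (vectorFun_mem _ h k)⟩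
    have := h₁ _ (vectorFun_mem _ (lp.single 2 0 h) (lp.single 2 0 k))
    rwa [vectorFun_ell2_single] at this
  · rintro ⟨h₁, h₂⟩
    refine ⟨?_, ?_, fun S _ => ?_⟩
    · rintro _ ⟨⟨h, k⟩, rfl⟩
      exact h₁.ampl h k
    · rintro _ ⟨⟨h, k⟩, rfl⟩
      exact h₂ h k
    · have hF := fun h k => integrable_of_lintegral_lt_top (h₁.ampl h k) (h₂ h k)
      obtain ⟨A, hA⟩ := exists_forall_inner_ampl_eq_setIntegral hF S
      refine ⟨⟨A, mem_of_forall_inner_ampl_eq_setIntegral hV hF hA⟩, ?_⟩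
      rintro _ ⟨⟨h, k⟩, rfl⟩
      exact hA h k

theorem norm_ampl_le (A : H →L[ℂ] K) : ‖ampl A‖ ≤ ‖A‖ := lp.norm_mapCLM_le ..

theorem topDual_sigmaOpTopologyOn_eq (T T' : OpTop) (V : Submodule ℂ (H →L[ℂ] K)) :
    topDual (sigmaOpTopologyOn T V) = topDual (sigmaOpTopologyOn T' V) := by
  rw [topDual_sigmaOpTopologyOn, topDual_sigmaOpTopologyOn]

/-- Norm continuity is what turns a σ-weakly continuous functional into an element of `predual V`.
-/
theorem continuous_of_mem_topDual_sigmaOpTopologyOn {V : Submodule ℂ (H →L[ℂ] K)} {T : OpTop}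
    {ℓ : V →ₗ[ℂ] ℂ} (hℓ : ℓ ∈ topDual (sigmaOpTopologyOn T V)) : Continuous ℓ := by
  rw [topDual_sigmaOpTopologyOn, SetLike.mem_coe] at hℓ
  induction hℓ using Submodule.span_induction with
  | mem g hg =>
    obtain ⟨⟨h, k⟩, rfl⟩ := hg
    refine (LinearMap.mkContinuous _ (‖k‖ * ‖h‖) fun A => ?_).continuous
    refine (norm_inner_le_norm (𝕜 := ℂ) k (ampl (A : H →L[ℂ] K) h)).trans ?_
    rw [mul_assoc]
    refine mul_le_mul_of_nonneg_left ?_ (norm_nonneg k)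
    rw [mul_comm]
    exact (ampl (A : H →L[ℂ] K)).le_of_opNorm_le (norm_ampl_le _) h
  | zero => exact continuous_const
  | add a b _ _ ha hb => exact ha.add hb
  | smul c a _ ha => exact ha.const_smul c

theorem exists_predual_coe_eq {V : Submodule ℂ (H →L[ℂ] K)} {T : OpTop}
    {ℓ : V →ₗ[ℂ] ℂ} (hℓ : ℓ ∈ topDual (sigmaOpTopologyOn T V)) :
    ∃ φ : predual V, ∀ A, (φ : StrongDual ℂ V) A = ℓ A := by
  refine ⟨⟨⟨ℓ, continuous_of_mem_topDual_sigmaOpTopologyOn hℓ⟩, ?_⟩, fun A => rfl⟩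
  rw [topDual_sigmaOpTopologyOn_eq T .weak] at hℓ
  exact hℓ

theorem predual_coe_mem_topDual {V : Submodule ℂ (H →L[ℂ] K)} (T : OpTop) (φ : predual V) :
    ((φ : StrongDual ℂ V) : V →ₗ[ℂ] ℂ) ∈ topDual (sigmaOpTopologyOn T V) := by
  rw [topDual_sigmaOpTopologyOn_eq T .weak]
  exact φ.2

/-- The evaluation functionals on a dual space. -/
def evalFun {X : Type*} [AddCommMonoid X] [Module ℂ X] [TopologicalSpace X] (x : X) :
    WeakDual ℂ X →ₗ[ℂ] ℂ where
  toFun Φ := Φ x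
  map_add' _ _ := rfl
  map_smul' _ _ := rfl

/-- The weak* topology is induced by the evaluations, and a functional is continuous for a topology
induced by a family of functionals exactly when it lies in their span. -/
theorem topDual_weakDual (X : Type*) [AddCommMonoid X] [Module ℂ X] [TopologicalSpace X] :
    topDual (inferInstance : TopologicalSpace (WeakDual ℂ X)) =
      Submodule.span ℂ (Set.range (evalFun (X := X))) := by
  let _ : AddCommGroup (WeakDual ℂ X) := Module.addCommMonoidToAddCommGroup ℂ
  ext ℓ
  refine Iff.trans ?_ (LinearMap.mem_span_iff_continuous (f := evalFun (X := X)) ℓ).symm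
  have : (inferInstance : TopologicalSpace (WeakDual ℂ X)) =
      ⨅ x, TopologicalSpace.induced (evalFun (X := X) x) inferInstance :=
    induced_to_pi _
  rw [← this]
  rfl

theorem topDual_weakStarTopology (V : Submodule ℂ (H →L[ℂ] K)) :
    topDual (weakStarTopology V) = Submodule.span ℂ (Set.range (evalFun (X := predual V))) :=
  topDual_weakDual (predual V)

theorem WeaklyIntegrable.weakStar {V : Submodule ℂ (H →L[ℂ] K)} {F : Ω → V} {T : OpTop}
    (hF : WeaklyIntegrable (sigmaOpTopologyOn T V) ρ F) :
    WeaklyIntegrable (weakStarTopology V) ρ fun ω => evPredual V (F ω) := by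
  rw [weaklyIntegrable_iff (topDual_weakStarTopology V)]
  refine ⟨?_, ?_, fun S hS => ?_⟩
  · rintro _ ⟨φ, rfl⟩
    exact measurable_sigmaGenBy_iff.1 hF.weaklyMeasurable _ ⟨_, predual_coe_mem_topDual T φ, rfl⟩
  · rintro _ ⟨φ, rfl⟩
    exact hF.lintegral_lt_top _ (predual_coe_mem_topDual T φ)
  · obtain ⟨A, hA⟩ := hF.exists_integral S hS
    refine ⟨evPredual V A, ?_⟩
    rintro _ ⟨φ, rfl⟩
    exact hA _ (predual_coe_mem_topDual T φ)

/-- The weak* integrals themselves do not enter; integrals in V come from closedness through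
`weaklyIntegrable_sigmaOpTopologyOn_iff`. -/
theorem WeaklyIntegrable.of_weakStar {V : Submodule ℂ (H →L[ℂ] K)} {F : Ω → V}
    (hF : WeaklyIntegrable (weakStarTopology V) ρ fun ω => evPredual V (F ω)) :
    PointwiseWeaklyMeasurable (fun ω => (F ω : H →L[ℂ] K)) ∧
      ∀ (h : ell2 H) (k : ell2 K),
        ∫⁻ ω, ‖inner ℂ k (ampl (F ω : H →L[ℂ] K) h)‖ₑ ∂ρ < ∞ := by
  obtain ⟨h₁, h₂, -⟩ := (weaklyIntegrable_iff (topDual_weakStarTopology V)).1 hF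
  have key : ∀ (h : ell2 H) (k : ell2 K),
      Measurable (fun ω => (inner ℂ k (ampl (F ω : H →L[ℂ] K) h) : ℂ)) ∧
      ∫⁻ ω, ‖inner ℂ k (ampl (F ω : H →L[ℂ] K) h)‖ₑ ∂ρ < ∞ := by
    intro h k
    obtain ⟨φ, hφ⟩ := exists_predual_coe_eq
      (vectorFun_mem_topDual_sigmaOpTopologyOn V .weak h k)
    have e : (fun ω => evalFun φ (evPredual V (F ω))) =
        fun ω => (inner ℂ k (ampl (F ω : H →L[ℂ] K) h) : ℂ) := funext fun ω => hφ (F ω)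
    refine ⟨e ▸ h₁ _ ⟨φ, rfl⟩, ?_⟩
    simp only [← congrFun e]
    exact h₂ _ ⟨φ, rfl⟩
  refine ⟨fun h k => ?_, fun h k => (key h k).2⟩
  simpa only [inner_ampl_single, if_true] using (key (lp.single 2 0 h) (lp.single 2 0 k)).1

theorem isWeakIntegral_weakStar_iff_eq {V : Submodule ℂ (H →L[ℂ] K)} {F : Ω → V} {T : OpTop}
    (hF : WeaklyIntegrable (sigmaOpTopologyOn T V) ρ F) {S : Set Ω} {A : V}
    (hA : IsWeakIntegral (sigmaOpTopologyOn T V) ρ F S A) (Φ : WeakDual ℂ (predual V)) :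
    IsWeakIntegral (weakStarTopology V) ρ (fun ω => evPredual V (F ω)) S Φ ↔
      Φ = evPredual V A := by
  have hW := topDual_weakStarTopology V
  refine isWeakIntegral_iff_eq ((isWeakIntegral_iff hW fun g hg => ?_).2 ?_) (fun w hw => ?_) Φ
  · exact hF.weakStar.integrable (by rw [hW]; exact Submodule.subset_span hg)
  · rintro _ ⟨φ, rfl⟩
    exact hA _ (predual_coe_mem_topDual T φ)
  · refine DFunLike.ext _ _ fun φ => hw (evalFun φ) ?_
    rw [hW]
    exact Submodule.subset_span ⟨φ, rfl⟩

theorem IsWeakIntegral.inner_eq_of_sigma {V : Submodule ℂ (H →L[ℂ] K)} {F : Ω → V} {T : OpTop}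
    {S : Set Ω} {A : V} (hA : IsWeakIntegral (sigmaOpTopologyOn T V) ρ F S A) (h : H) (k : K) :
    inner ℂ k ((A : H →L[ℂ] K) h) = ∫ ω in S, inner ℂ k ((F ω : H →L[ℂ] K) h) ∂ρ := by
  have := hA _ (vectorFun_mem_topDual_sigmaOpTopologyOn V T (lp.single 2 0 h) (lp.single 2 0 k))
  rwa [vectorFun_ell2_single] at this

theorem WeaklyIntegrable.pointwisePettisIntegrableIn {V : Submodule ℂ (H →L[ℂ] K)} {F : Ω → V}
    {T : OpTop} (hF : WeaklyIntegrable (sigmaOpTopologyOn T V) ρ F) :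
    PointwisePettisIntegrableIn V ρ F := by
  have key : ∀ (h : H) (k : K),
      Measurable (fun ω => (inner ℂ k ((F ω : H →L[ℂ] K) h) : ℂ)) ∧
      ∫⁻ ω, ‖inner ℂ k ((F ω : H →L[ℂ] K) h)‖ₑ ∂ρ < ∞ := by
    intro h k
    have hm := vectorFun_mem_topDual_sigmaOpTopologyOn V T (lp.single 2 0 h) (lp.single 2 0 k)
    rw [vectorFun_ell2_single] at hm
    exact ⟨measurable_sigmaGenBy_iff.1 hF.weaklyMeasurable _ ⟨_, hm, rfl⟩,
      hF.lintegral_lt_top _ hm⟩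
  refine ⟨⟨fun h k => (key h k).1, fun h k => (key h k).2⟩, fun S hS => ?_⟩
  obtain ⟨A, hA⟩ := hF.exists_integral S hS
  exact ⟨A, A.2, isPointwisePettisIntegral_iff.2 hA.inner_eq_of_sigma⟩

end SigmaClosed

/-! ### Monotone limits of operators -/

section MonotoneLimits

open ContinuousLinearMap (adjoint)

variable {H : Type*} [NormedAddCommGroup H] [InnerProductSpace ℂ H] [CompleteSpace H]

theorem nonneg_iff_inner {T : H →L[ℂ] H} :
    0 ≤ T ↔ ∀ v, (inner ℂ (T v) v : ℂ).im = 0 ∧ 0 ≤ (inner ℂ (T v) v : ℂ).re := by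
  rw [ContinuousLinearMap.nonneg_iff_isPositive, ContinuousLinearMap.isPositive_iff_complex]
  refine forall_congr' fun v => and_congr_left fun _ => ?_
  simp [Complex.ext_iff, eq_comm]

theorem re_inner_mono {S T : H →L[ℂ] H} (h : S ≤ T) (v : H) :
    (inner ℂ (S v) v : ℂ).re ≤ (inner ℂ (T v) v : ℂ).re := by
  have := (nonneg_iff_inner.1 (sub_nonneg.2 h) v).2
  rw [sub_apply, inner_sub_left, Complex.sub_re] at this
  linarith

theorem nonneg_of_tendsto {ι : Type*} {U : Filter ι} [U.NeBot] {x : ι → H →L[ℂ] H}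
    {T : H →L[ℂ] H} (hx : ∀ᶠ i in U, 0 ≤ x i)
    (hT : ∀ v, Filter.Tendsto (fun i => (inner ℂ (x i v) v : ℂ)) U (𝓝 (inner ℂ (T v) v))) :
    0 ≤ T := by
  rw [nonneg_iff_inner]
  intro v
  refine ⟨tendsto_nhds_unique ((Complex.continuous_im.tendsto _).comp (hT v)) ?_,
    ge_of_tendsto ((Complex.continuous_re.tendsto _).comp (hT v)) ?_⟩
  · refine tendsto_const_nhds.congr' ?_
    filter_upwards [hx] with i hi
    exact (nonneg_iff_inner.1 hi v).1.symm
  · filter_upwards [hx] with i hi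
    exact (nonneg_iff_inner.1 hi v).2

/-- Bounded families of operators have weak limits along ultrafilters. -/
theorem exists_tendsto_inner_ultrafilter {ι : Type*} (U : Ultrafilter ι) (x : ι → H →L[ℂ] H)
    (C : ℝ) (hx : ∀ i, ‖x i‖ ≤ C) :
    ∃ a : H →L[ℂ] H, ∀ v w, Filter.Tendsto (fun i => (inner ℂ (x i v) w : ℂ)) U
      (𝓝 (inner ℂ (a v) w)) := by
  have hb : ∀ v w i, ‖(inner ℂ (x i v) w : ℂ)‖ ≤ C * ‖v‖ * ‖w‖ := fun v w i =>
    (norm_inner_le_norm _ _).trans (mul_le_mul_of_nonneg_right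
      ((x i).le_of_opNorm_le (hx i) v) (norm_nonneg w))
  have hl : ∀ v w, ∃ z : ℂ, ‖z‖ ≤ C * ‖v‖ * ‖w‖ ∧
      Filter.Tendsto (fun i => (inner ℂ (x i v) w : ℂ)) U (𝓝 z) := by
    intro v w
    obtain ⟨z, hz, hzU⟩ := (isCompact_closedBall (0 : ℂ) (C * ‖v‖ * ‖w‖)).ultrafilter_le_nhds
      (U.map fun i => (inner ℂ (x i v) w : ℂ)) (by
        rw [Filter.le_principal_iff]
        exact Filter.mem_map.2 (Filter.univ_mem' fun i => by
          simpa using hb v w i))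
    exact ⟨z, by simpa using hz, hzU⟩
  choose l hlb hlt using hl
  -- Ultrafilter limits inherit sesquilinearity and the bound, so they come from an operator.
  let B : H →ₗ⋆[ℂ] H →ₗ[ℂ] ℂ := LinearMap.mk₂'ₛₗ (starRingEnd ℂ) (RingHom.id ℂ) l
    (fun v₁ v₂ w => tendsto_nhds_unique (hlt _ _) (by
      simpa only [map_add, inner_add_left] using (hlt v₁ w).add (hlt v₂ w)))
    (fun c v w => tendsto_nhds_unique (hlt _ _) (by
      simpa only [map_smul, inner_smul_left, smul_eq_mul] using (hlt v w).const_mul ((starRingEnd ℂ) c)))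
    (fun v w₁ w₂ => tendsto_nhds_unique (hlt _ _) (by
      simpa only [inner_add_right] using (hlt v w₁).add (hlt v w₂)))
    (fun c v w => tendsto_nhds_unique (hlt _ _) (by
      simpa only [inner_smul_right, smul_eq_mul, RingHom.id_apply] using (hlt v w).const_mul c))
  refine ⟨InnerProductSpace.continuousLinearMapOfBilin (B.mkContinuous₂ C fun v w => hlb v w),
    fun v w => ?_⟩
  rw [InnerProductSpace.continuousLinearMapOfBilin_apply]
  exact hlt v w

/-- A nonempty chain of operators between `0` and `1` has a least upper bound, which is a weak
limit of the chain. -/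
theorem exists_weak_lub {c : Set (H →L[ℂ] H)} (hne : c.Nonempty) (hc : IsChain (· ≤ ·) c)
    (hb : ∀ x ∈ c, 0 ≤ x ∧ x ≤ 1) :
    ∃ a : H →L[ℂ] H, (∀ y, (∀ x ∈ c, x * y = y * x) → a * y = y * a) ∧ IsLUB c a ∧
      ∀ v, ∀ ε > 0, ∃ x ∈ c, (inner ℂ (a v) v : ℂ).re - ε < (inner ℂ (x v) v : ℂ).re := by
  have : Nonempty c := hne.to_subtype
  have : IsDirectedOrder c := directedOn_iff_isDirectedOrder.1 hc.directedOn
  -- The chain is indexed by itself. A weak limit along an ultrafilter finer than `atTop` inherits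
  -- the order relations and commutes with whatever commutes with the chain.
  let U : Ultrafilter c := Ultrafilter.of Filter.atTop
  have hU : (U : Filter c) ≤ Filter.atTop := Ultrafilter.of_le _
  obtain ⟨a, ha⟩ := exists_tendsto_inner_ultrafilter U (fun x : c => (x : H →L[ℂ] H)) 1
    fun x => CStarAlgebra.norm_le_one_iff_of_nonneg _ (hb x x.2).1 |>.2 (hb x x.2).2
  have hsub : ∀ (b : H →L[ℂ] H) (v), Filter.Tendsto
      (fun x : c => (inner ℂ (((x : H →L[ℂ] H) - b) v) v : ℂ)) U (𝓝 (inner ℂ ((a - b) v) v)) := by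
    intro b v
    simp only [sub_apply, inner_sub_left]
    exact (ha v v).sub_const _
  have hsub' : ∀ (b : H →L[ℂ] H) (v), Filter.Tendsto
      (fun x : c => (inner ℂ ((b - (x : H →L[ℂ] H)) v) v : ℂ)) U (𝓝 (inner ℂ ((b - a) v) v)) := by
    intro b v
    simp only [sub_apply, inner_sub_left]
    exact (ha v v).const_sub _
  refine ⟨a, fun y hy => ?_, ⟨fun b hbc => ?_, fun b hbc => ?_⟩, fun v ε hε => ?_⟩
  · ext v
    refine ext_inner_right ℂ fun w => ?_
    have h1 := ha (y v) w
    have h2 := ha v (adjoint y w)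
    rw [ContinuousLinearMap.adjoint_inner_right] at h2
    refine tendsto_nhds_unique h1 (h2.congr fun x => ?_)
    rw [ContinuousLinearMap.adjoint_inner_right]
    have := congrArg (fun T : H →L[ℂ] H => (inner ℂ (T v) w : ℂ)) (hy x x.2)
    exact this.symm
  · rw [← sub_nonneg]
    refine nonneg_of_tendsto (hU ?_) (hsub b)
    filter_upwards [Filter.eventually_ge_atTop (⟨b, hbc⟩ : c)] with x hx
    exact sub_nonneg.2 hx
  · rw [← sub_nonneg]
    exact nonneg_of_tendsto (Filter.Eventually.of_forall fun x => sub_nonneg.2 (hbc x.2)) (hsub' b)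
  · have h1 := (Complex.continuous_re.tendsto _).comp (ha v v)
    obtain ⟨x, hx⟩ := (h1.eventually (lt_mem_nhds (sub_lt_self _ hε))).exists
    exact ⟨x, x.2, hx⟩

end MonotoneLimits

/-! ### Von Neumann algebras and their isomorphisms -/

section VonNeumann

open ContinuousLinearMap (adjoint)

variable {H : Type*} [NormedAddCommGroup H] [InnerProductSpace ℂ H] [CompleteSpace H]

/-- M is its own double commutant; this keeps square roots and weak limits inside M. -/
theorem mem_of_forall_commute {M : VonNeumannAlgebra H} {a : H →L[ℂ] H}
    (h : ∀ y, (∀ x ∈ M.toStarSubalgebra, x * y = y * x) → a * y = y * a) :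
    a ∈ M.toStarSubalgebra := by
  have : a ∈ Set.centralizer (Set.centralizer (M : Set (H →L[ℂ] H))) := fun y hy =>
    (h y fun x hx => hy x hx).symm
  rwa [VonNeumannAlgebra.centralizer_centralizer] at this

variable {M : VonNeumannAlgebra H}

theorem exists_mul_self_eq {x : M.toStarSubalgebra} (hx : 0 ≤ x) :
    ∃ r : M.toStarSubalgebra, star r = r ∧ r * r = x := by
  have hx' : (0 : H →L[ℂ] H) ≤ x := hx
  refine ⟨⟨CFC.sqrt (x : H →L[ℂ] H), mem_of_forall_commute fun y hy => ?_⟩, Subtype.ext ?_,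
    Subtype.ext (CFC.sqrt_mul_sqrt_self _ hx')⟩
  · exact (show Commute (x : H →L[ℂ] H) y from hy x x.2).cfcₙ_nnreal _
  · exact (CFC.sqrt_nonneg (x : H →L[ℂ] H)).isSelfAdjoint

theorem star_mul_self_nonneg' (x : M.toStarSubalgebra) : 0 ≤ star x * x :=
  star_mul_self_nonneg (x : H →L[ℂ] H)

theorem re_inner_mono' {x y : M.toStarSubalgebra} (h : x ≤ y) (v : H) :
    (inner ℂ ((x : H →L[ℂ] H) v) v : ℂ).re ≤ (inner ℂ ((y : H →L[ℂ] H) v) v : ℂ).re :=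
  re_inner_mono h v

theorem norm_sq_apply (x : M.toStarSubalgebra) (v : H) :
    ‖(x : H →L[ℂ] H) v‖ ^ 2 =
      (inner ℂ (((star x * x : M.toStarSubalgebra) : H →L[ℂ] H) v) v : ℂ).re := by
  change _ = (inner ℂ (adjoint (x : H →L[ℂ] H) ((x : H →L[ℂ] H) v)) v : ℂ).re
  rw [ContinuousLinearMap.adjoint_inner_left, inner_self_eq_norm_sq_to_K]
  norm_cast

theorem exists_isLUB_of_isChain {c : Set M.toStarSubalgebra} (hne : c.Nonempty)
    (hc : IsChain (· ≤ ·) c) (hb : ∀ x ∈ c, 0 ≤ x ∧ x ≤ 1) :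
    ∃ a, IsLUB c a ∧ ∀ v, ∀ ε > 0, ∃ x ∈ c,
      (inner ℂ ((a : H →L[ℂ] H) v) v : ℂ).re - ε < (inner ℂ ((x : H →L[ℂ] H) v) v : ℂ).re := by
  obtain ⟨a, ha, hlub, hv⟩ := exists_weak_lub (c := Subtype.val '' c) (hne.image _)
    (IsChain.image_of_map_rel (· ≤ ·) (· ≤ ·) Subtype.val (fun _ _ h => h) hc) (by
      rintro _ ⟨x, hx, rfl⟩
      exact hb x hx)
  refine ⟨⟨a, mem_of_forall_commute fun y hy => ha y ?_⟩, ⟨fun x hx => ?_, fun b hb => ?_⟩,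
    fun v ε hε => ?_⟩
  · rintro _ ⟨x, hx, rfl⟩
    exact hy x x.2
  · exact hlub.1 ⟨x, hx, rfl⟩
  · refine hlub.2 ?_
    rintro _ ⟨x, hx, rfl⟩
    exact hb hx
  · obtain ⟨_, ⟨x, hx, rfl⟩, h⟩ := hv v ε hε
    exact ⟨x, hx, h⟩

/-- By uniqueness of suprema, one defined by the order of M alone is the weak limit of the chain.
This is how order isomorphisms come to respect such limits. -/
theorem exists_re_inner_lt_of_isLUB {c : Set M.toStarSubalgebra} (hne : c.Nonempty)
    (hc : IsChain (· ≤ ·) c) (hb : ∀ x ∈ c, 0 ≤ x ∧ x ≤ 1) {a : M.toStarSubalgebra}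
    (ha : IsLUB c a) (v : H) {ε : ℝ} (hε : 0 < ε) : ∃ x ∈ c,
      (inner ℂ ((a : H →L[ℂ] H) v) v : ℂ).re - ε < (inner ℂ ((x : H →L[ℂ] H) v) v : ℂ).re := by
  obtain ⟨a', ha', h⟩ := exists_isLUB_of_isChain hne hc hb
  rw [ha.unique ha']
  exact h v ε hε

variable {L : Type*} [NormedAddCommGroup L] [InnerProductSpace ℂ L] [CompleteSpace L]
  {N : VonNeumannAlgebra L} (π : M.toStarSubalgebra ≃⋆ₐ[ℂ] N.toStarSubalgebra)

/-- Positivity is algebraic: a positive element is r* r with r in M. -/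
theorem starAlgEquiv_nonneg {x : M.toStarSubalgebra} (hx : 0 ≤ x) : 0 ≤ π x := by
  obtain ⟨r, hr, rfl⟩ := exists_mul_self_eq hx
  have : π (r * r) = star (π r) * π r := by rw [← map_star, hr, map_mul]
  rw [this]
  exact star_mul_self_nonneg' _

theorem starAlgEquiv_mono {x y : M.toStarSubalgebra} (h : x ≤ y) : π x ≤ π y := by
  rw [← sub_nonneg, ← map_sub]
  exact starAlgEquiv_nonneg π (sub_nonneg.2 h)

theorem starAlgEquiv_le_iff {x y : M.toStarSubalgebra} : π x ≤ π y ↔ x ≤ y := by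
  refine ⟨fun h => ?_, starAlgEquiv_mono π⟩
  simpa using starAlgEquiv_mono π.symm h

/-- Isomorphisms of von Neumann algebras are normal. -/
theorem exists_re_inner_map_lt_of_isLUB {c : Set M.toStarSubalgebra} (hne : c.Nonempty)
    (hc : IsChain (· ≤ ·) c) (hb : ∀ x ∈ c, 0 ≤ x ∧ x ≤ 1) {a : M.toStarSubalgebra}
    (ha : IsLUB c a) (ξ : L) {ε : ℝ} (hε : 0 < ε) : ∃ x ∈ c,
      (inner ℂ ((π a : L →L[ℂ] L) ξ) ξ : ℂ).re - ε < (inner ℂ ((π x : L →L[ℂ] L) ξ) ξ : ℂ).re := by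
  have hlub : IsLUB (π '' c) (π a) := by
    refine ⟨?_, fun b hb' => ?_⟩
    · rintro _ ⟨x, hx, rfl⟩
      exact starAlgEquiv_mono π (ha.1 hx)
    · rw [← π.apply_symm_apply b, starAlgEquiv_le_iff]
      refine ha.2 fun x hx => ?_
      rw [← starAlgEquiv_le_iff π, π.apply_symm_apply]
      exact hb' ⟨x, hx, rfl⟩
  obtain ⟨_, ⟨x, hx, rfl⟩, h⟩ := exists_re_inner_lt_of_isLUB (hne.image π)
    (IsChain.image_of_map_rel _ _ _ (fun _ _ h => starAlgEquiv_mono π h) hc) (by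
      rintro _ ⟨x, hx, rfl⟩
      refine ⟨starAlgEquiv_nonneg π (hb x hx).1, ?_⟩
      rw [← map_one π]
      exact starAlgEquiv_mono π (hb x hx).2) hlub ξ hε
  exact ⟨x, hx, h⟩

theorem star_mul_self_le_norm_sq (x : M.toStarSubalgebra) :
    star x * x ≤ ((‖x‖ ^ 2 : ℝ) : ℂ) • (1 : M.toStarSubalgebra) := by
  have h := CStarAlgebra.star_mul_le_algebraMap_norm_sq (a := (x : H →L[ℂ] H))
  rw [Algebra.algebraMap_eq_smul_one, ← Complex.coe_smul] at h
  exact h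

/-- Order preservation applied to x* x ≤ ‖x‖² 1. -/
theorem norm_map_apply_le (x : M.toStarSubalgebra) (ξ : L) :
    ‖(π x : L →L[ℂ] L) ξ‖ ≤ ‖x‖ * ‖ξ‖ := by
  refine le_of_sq_le_sq ?_ (by positivity)
  rw [norm_sq_apply, ← map_star, ← map_mul]
  refine (re_inner_mono' (starAlgEquiv_mono π (star_mul_self_le_norm_sq x)) ξ).trans (le_of_eq ?_)
  rw [map_smul, map_one]
  change (inner ℂ (((‖x‖ ^ 2 : ℝ) : ℂ) • ξ) ξ : ℂ).re = _
  rw [inner_smul_left, inner_self_eq_norm_sq_to_K, Complex.conj_ofReal, mul_pow,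
    Complex.re_ofReal_mul]
  norm_cast

end VonNeumann

/-! ### Pulling vector functionals back along isomorphisms -/

section NormalFunctionals

variable {H : Type*} [NormedAddCommGroup H] [InnerProductSpace ℂ H] [CompleteSpace H]

/-- The inclusion of a von Neumann algebra on `H` in `B(H)`. -/
def inclₗ (M : VonNeumannAlgebra H) : M.toStarSubalgebra →ₗ[ℂ] (H →L[ℂ] H) where
  toFun := Subtype.val
  map_add' _ _ := rfl
  map_smul' _ _ := rfl

/-- The norm closure of the span of the vector functionals on a von Neumann algebra. -/
def closedVectorFuns (M : VonNeumannAlgebra H) :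
    Submodule ℂ (M.toStarSubalgebra →ₗ[ℂ] ℂ) where
  carrier := {ℓ | ∀ ε > 0, ∃ ψ ∈ Submodule.span ℂ (vectorFuns (inclₗ M)),
    ∀ x, ‖ℓ x - ψ x‖ ≤ ε * ‖x‖}
  zero_mem' ε hε := ⟨0, Submodule.zero_mem _, fun x => by
    simpa using mul_nonneg (le_of_lt hε) (norm_nonneg x)⟩
  add_mem' {a b} ha hb ε hε := by
    obtain ⟨φ, hφ, h₁⟩ := ha (ε / 2) (half_pos hε)
    obtain ⟨ψ, hψ, h₂⟩ := hb (ε / 2) (half_pos hε)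
    refine ⟨φ + ψ, Submodule.add_mem _ hφ hψ, fun x => ?_⟩
    calc ‖(a + b) x - (φ + ψ) x‖ = ‖(a x - φ x) + (b x - ψ x)‖ := by
          simp only [LinearMap.add_apply]; congr 1; ring
      _ ≤ ε / 2 * ‖x‖ + ε / 2 * ‖x‖ := (norm_add_le _ _).trans (add_le_add (h₁ x) (h₂ x))
      _ = ε * ‖x‖ := by ring
  smul_mem' c a ha ε hε := by
    have hc : 0 < ‖c‖ + 1 := by positivity
    obtain ⟨φ, hφ, h₁⟩ := ha (ε / (‖c‖ + 1)) (by positivity)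
    refine ⟨c • φ, Submodule.smul_mem _ c hφ, fun x => ?_⟩
    calc ‖(c • a) x - (c • φ) x‖ = ‖c‖ * ‖a x - φ x‖ := by
          simp only [LinearMap.smul_apply, ← smul_sub, norm_smul]
      _ ≤ (‖c‖ + 1) * (ε / (‖c‖ + 1) * ‖x‖) :=
          mul_le_mul (by linarith) (h₁ x) (norm_nonneg _) hc.le
      _ = ε * ‖x‖ := by field_simp

variable {M : VonNeumannAlgebra H}

theorem mem_closedVectorFuns_of_forall_approx {ℓ : M.toStarSubalgebra →ₗ[ℂ] ℂ}
    (h : ∀ ε > 0, ∃ ψ ∈ closedVectorFuns M, ∀ x, ‖ℓ x - ψ x‖ ≤ ε * ‖x‖) :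
    ℓ ∈ closedVectorFuns M := by
  intro ε hε
  obtain ⟨φ, hφ, h₁⟩ := h (ε / 2) (half_pos hε)
  obtain ⟨ψ, hψ, h₂⟩ := hφ (ε / 2) (half_pos hε)
  refine ⟨ψ, hψ, fun x => ?_⟩
  calc ‖ℓ x - ψ x‖ = ‖(ℓ x - φ x) + (φ x - ψ x)‖ := by congr 1; ring
    _ ≤ ε / 2 * ‖x‖ + ε / 2 * ‖x‖ := (norm_add_le _ _).trans (add_le_add (h₁ x) (h₂ x))
    _ = ε * ‖x‖ := by ring

theorem vectorFun_mem_closedVectorFuns (h k : H) :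
    vectorFun (inclₗ M) h k ∈ closedVectorFuns M := fun _ hε =>
  ⟨_, Submodule.subset_span (vectorFun_mem _ h k), fun x => by
    simpa using mul_nonneg (le_of_lt hε) (norm_nonneg x)⟩

variable {L : Type*} [NormedAddCommGroup L] [InnerProductSpace ℂ L] [CompleteSpace L]
  {N : VonNeumannAlgebra L} (π : M.toStarSubalgebra ≃⋆ₐ[ℂ] N.toStarSubalgebra)

/-- The representation of a von Neumann algebra on `L` given by an isomorphism with a von Neumann
algebra on `L`. -/
def reprₗ : M.toStarSubalgebra →ₗ[ℂ] (L →L[ℂ] L) where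
  toFun x := (π x : L →L[ℂ] L)
  map_add' x y := by rw [map_add]; rfl
  map_smul' c x := by rw [map_smul]; rfl

@[simp]
theorem reprₗ_apply (x : M.toStarSubalgebra) : reprₗ π x = (π x : L →L[ℂ] L) := rfl

theorem exists_re_inner_pos {q : M.toStarSubalgebra} (hq : 0 ≤ q) (hq0 : q ≠ 0) :
    ∃ v : H, 0 < (inner ℂ ((q : H →L[ℂ] H) v) v : ℂ).re := by
  by_contra! hcon
  apply hq0
  have hpos := nonneg_iff_inner.1 (show (0 : H →L[ℂ] H) ≤ q from hq)
  have h0 : ((q : H →L[ℂ] H) : H →ₗ[ℂ] H) = 0 :=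
    (inner_map_self_eq_zero _).1 fun v =>
      Complex.ext (le_antisymm (hcon v) (hpos v).2) (hpos v).1
  refine Subtype.ext (ContinuousLinearMap.ext fun v => ?_)
  exact LinearMap.congr_fun h0 v

/-- A vector state composed with an isomorphism is dominated by a vector functional below some
nonzero positive element. -/
theorem exists_forall_le_re_inner_map_le (ξ : L) {q : M.toStarSubalgebra} (hq : 0 ≤ q)
    (hq1 : q ≤ 1) (hq0 : q ≠ 0) :
    ∃ b : M.toStarSubalgebra, 0 ≤ b ∧ b ≤ q ∧ b ≠ 0 ∧ ∃ η : H, ∀ c, 0 ≤ c → c ≤ b →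
      (inner ℂ ((π c : L →L[ℂ] L) ξ) ξ : ℂ).re ≤ (inner ℂ ((c : H →L[ℂ] H) η) η : ℂ).re := by
  obtain ⟨v, hv⟩ := exists_re_inner_pos hq hq0
  set ω : M.toStarSubalgebra → ℝ := fun x => (inner ℂ ((π x : L →L[ℂ] L) ξ) ξ : ℂ).re with hω
  have hωadd : ∀ x y, ω (x + y) = ω x + ω y := fun x y => by
    simp only [hω, map_add, ← Complex.add_re, ← inner_add_left]
    rfl
  obtain ⟨t, ht⟩ : ∃ t : ℝ, ω q < t ^ 2 * (inner ℂ ((q : H →L[ℂ] H) v) v : ℂ).re := by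
    set a := (inner ℂ ((q : H →L[ℂ] H) v) v : ℂ).re
    refine ⟨|ω q| / a + 1, ?_⟩
    have h1 : (|ω q| / a + 1) ^ 2 * a = |ω q| * (|ω q| / a) + 2 * |ω q| + a := by
      field_simp
      ring
    have h2 : 0 ≤ |ω q| * (|ω q| / a) := by positivity
    rw [h1]
    linarith [le_abs_self (ω q), abs_nonneg (ω q)]
  set η : H := (t : ℂ) • v with hη
  set φ : M.toStarSubalgebra → ℝ := fun x => (inner ℂ ((x : H →L[ℂ] H) η) η : ℂ).re with hφ
  have hφadd : ∀ x y, φ (x + y) = φ x + φ y := fun x y => by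
    simp only [hφ, ← Complex.add_re, ← inner_add_left]
    rfl
  have hφq : ω q < φ q := by
    refine ht.trans_eq ?_
    simp only [hφ, hη, map_smul, inner_smul_left, inner_smul_right, Complex.conj_ofReal,
      Complex.re_ofReal_mul]
    ring
  -- For a maximal a in s take b = q - a. It is nonzero because φ q > ω q, and an element 0 ≤ c ≤ b
  -- with φ c < ω c would put a + c in s.
  let s : Set M.toStarSubalgebra := {c | 0 ≤ c ∧ c ≤ q ∧ φ c ≤ ω c}
  obtain ⟨a, -, ha, hmax⟩ := zorn_le_nonempty₀ s (fun c hcs hc y hy => by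
    have hne : c.Nonempty := ⟨y, hy⟩
    have hb : ∀ x ∈ c, 0 ≤ x ∧ x ≤ 1 := fun x hx => ⟨(hcs hx).1, (hcs hx).2.1.trans hq1⟩
    obtain ⟨u, hu, hux⟩ := exists_isLUB_of_isChain hne hc hb
    refine ⟨u, ⟨(hcs hy).1.trans (hu.1 hy), hu.2 fun x hx => (hcs hx).2.1, ?_⟩, fun z hz => hu.1 hz⟩
    -- Along the chain φ approximates its value at the supremum while ω is monotone, so φ ≤ ω passes
    -- to the supremum.
    refine le_of_forall_pos_le_add fun ε hε => ?_
    obtain ⟨x, hx, hxε⟩ := hux η ε hε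
    have h1 : φ u - ε < φ x := hxε
    have h2 : ω x ≤ ω u := re_inner_mono' (starAlgEquiv_mono π (hu.1 hx)) ξ
    linarith [(hcs hx).2.2]) 0 ⟨le_rfl, hq, by simp [hφ, hω]⟩
  refine ⟨q - a, sub_nonneg.2 ha.2.1, sub_le_self q ha.1, fun h0 => ?_, η, fun c hc hcb => ?_⟩
  · rw [sub_eq_zero] at h0
    rw [← h0] at ha
    exact absurd ha.2.2 hφq.not_ge
  · by_cases hc0 : c = 0
    · simp [hc0]
    by_contra! hlt
    have hmem : a + c ∈ s := by
      refine ⟨add_nonneg ha.1 hc, by rwa [← le_sub_iff_add_le'], ?_⟩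
      rw [hωadd, hφadd]
      exact add_le_add ha.2.2 hlt.le
    have := hmax hmem (le_add_of_nonneg_right hc)
    exact hc0 (le_antisymm (by simpa using this) hc)

/-- Write b = r². Since (xr)*(xr) ≤ ‖x‖² b, domination below b yields ‖π(xr)ξ‖ ≤ ‖x r η‖, and Riesz
turns x ↦ ⟨π(xr)ξ, ξ⟩ into a vector functional at r η. -/
theorem exists_map_mul_eq_vectorFun (ξ : L) {q : M.toStarSubalgebra} (hq : 0 ≤ q)
    (hq1 : q ≤ 1) (hq0 : q ≠ 0) :
    ∃ b : M.toStarSubalgebra, 0 ≤ b ∧ b ≤ q ∧ b ≠ 0 ∧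
      vectorFun (reprₗ π) ξ ξ ∘ₗ LinearMap.mulRight ℂ b ∈ closedVectorFuns M := by
  obtain ⟨b, hb, hbq, hb0, η, hη⟩ := exists_forall_le_re_inner_map_le π ξ hq hq1 hq0
  obtain ⟨r, hr, hrb⟩ := exists_mul_self_eq hb
  refine ⟨b, hb, hbq, hb0, ?_⟩
  have hdom : ∀ x : M.toStarSubalgebra,
      ‖(π (x * r) : L →L[ℂ] L) ξ‖ ≤ ‖((x * r : M.toStarSubalgebra) : H →L[ℂ] H) η‖ := by
    intro x
    -- The summand 1 allows division by n even when x = 0.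
    set n : ℝ := ‖x‖ ^ 2 + 1 with hn
    have hn0 : 0 < n := by positivity
    set d : M.toStarSubalgebra := star (x * r) * (x * r) with hd
    have hd0 : 0 ≤ d := star_mul_self_nonneg' _
    have hdb : d ≤ (n : ℂ) • b := by
      have h1 : d ≤ ((‖x‖ ^ 2 : ℝ) : ℂ) • b := by
        have h2 : star r * (star x * x) * r ≤
            star r * (((‖x‖ ^ 2 : ℝ) : ℂ) • (1 : M.toStarSubalgebra)) * r :=
          star_left_conjugate_le_conjugate
            (show ((star x * x : M.toStarSubalgebra) : H →L[ℂ] H) ≤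
              ((((‖x‖ ^ 2 : ℝ) : ℂ) • (1 : M.toStarSubalgebra) : M.toStarSubalgebra) :
                H →L[ℂ] H) from star_mul_self_le_norm_sq x) (r : H →L[ℂ] H)
        rw [mul_smul_comm, smul_mul_assoc, mul_one, hr, hrb] at h2
        rw [hd, star_mul, hr]
        simpa only [mul_assoc] using h2
      refine h1.trans ?_
      rw [hn, Complex.ofReal_add, add_smul, Complex.ofReal_one, one_smul]
      exact le_add_of_nonneg_right hb
    have hsm : ∀ {y z : M.toStarSubalgebra}, y ≤ z →
        ((n⁻¹ : ℝ) : ℂ) • y ≤ ((n⁻¹ : ℝ) : ℂ) • z := by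
      intro y z hyz
      have : (n⁻¹ : ℝ) • (y : H →L[ℂ] H) ≤ (n⁻¹ : ℝ) • (z : H →L[ℂ] H) :=
        smul_le_smul_of_nonneg_left hyz (by positivity)
      rw [← Complex.coe_smul, ← Complex.coe_smul] at this
      exact this
    have hle := hη (((n⁻¹ : ℝ) : ℂ) • d) (by simpa using hsm hd0) (by
      refine (hsm hdb).trans (le_of_eq ?_)
      rw [smul_smul, ← Complex.ofReal_mul, inv_mul_cancel₀ hn0.ne', Complex.ofReal_one, one_smul])
    have hsc : ∀ (z : ℂ), (((n⁻¹ : ℝ) : ℂ) * z).re = n⁻¹ * z.re := fun z =>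
      Complex.re_ofReal_mul _ _
    rw [map_smul] at hle
    change (inner ℂ (((n⁻¹ : ℝ) : ℂ) • (π d : L →L[ℂ] L) ξ) ξ : ℂ).re ≤
      (inner ℂ (((n⁻¹ : ℝ) : ℂ) • (d : H →L[ℂ] H) η) η : ℂ).re at hle
    rw [inner_smul_left, inner_smul_left, Complex.conj_ofReal, hsc, hsc,
      mul_le_mul_iff_right₀ (by positivity)] at hle
    refine le_of_sq_le_sq ?_ (norm_nonneg _)
    rw [norm_sq_apply, norm_sq_apply, ← map_star, ← map_mul]
    exact hle
  have hrepr : ∃ k, ∀ x, vectorFun (reprₗ π) ξ ξ (x * r) =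
      vectorFun (inclₗ M) ((r : H →L[ℂ] H) η) k x := by
    let ℓ : M.toStarSubalgebra →ₗ[ℂ] ℂ := vectorFun (reprₗ π) ξ ξ ∘ₗ LinearMap.mulRight ℂ r
    obtain ⟨k, hk⟩ := exists_vectorFun_re_eq (inclₗ M) (Complex.reLm ∘ₗ ℓ.restrictScalars ℝ)
      (norm_nonneg ξ) ((r : H →L[ℂ] H) η) fun x => by
        refine (Complex.abs_re_le_norm (ℓ x)).trans ?_
        refine (norm_inner_le_norm (𝕜 := ℂ) ξ _).trans ?_
        exact mul_le_mul_of_nonneg_left (hdom x) (norm_nonneg ξ)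
    exact ⟨k, LinearMap.congr_fun (linearMap_ext_re (φ := ℓ) hk)⟩
  obtain ⟨k, hk⟩ := hrepr
  -- The representation is used at x r, since x b = (x r) r.
  have heq : vectorFun (reprₗ π) ξ ξ ∘ₗ LinearMap.mulRight ℂ b =
      vectorFun (inclₗ M) ((r : H →L[ℂ] H) ((r : H →L[ℂ] H) η)) k := by
    ext x
    rw [LinearMap.comp_apply, LinearMap.mulRight_apply, ← hrb, ← mul_assoc, hk]
    rfl
  rw [heq]
  exact vectorFun_mem_closedVectorFuns _ _

/-- Exhaustion by Zorn's lemma over those 0 ≤ a ≤ 1 for which x ↦ ⟨π(xa)ξ, ξ⟩ lies in the closed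
span. Chains are bounded in this set because π is normal and the span is norm closed. A maximal a
equals 1, since otherwise `exists_map_mul_eq_vectorFun` with q = 1 - a enlarges it. -/
theorem vectorFun_reprₗ_self_mem (ξ : L) : vectorFun (reprₗ π) ξ ξ ∈ closedVectorFuns M := by
  let s : Set M.toStarSubalgebra := {a | 0 ≤ a ∧ a ≤ 1 ∧
    vectorFun (reprₗ π) ξ ξ ∘ₗ LinearMap.mulRight ℂ a ∈ closedVectorFuns M}
  have h01 : (0 : M.toStarSubalgebra) ≤ 1 := zero_le_one (α := H →L[ℂ] H)
  obtain ⟨a, -, ha, hmax⟩ := zorn_le_nonempty₀ s (fun c hcs hc y hy => by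
    have hne : c.Nonempty := ⟨y, hy⟩
    have hb : ∀ x ∈ c, 0 ≤ x ∧ x ≤ 1 := fun x hx => ⟨(hcs hx).1, (hcs hx).2.1⟩
    obtain ⟨u, hu, -⟩ := exists_isLUB_of_isChain hne hc hb
    have hu1 : u ≤ 1 := hu.2 fun x hx => (hcs hx).2.1
    refine ⟨u, ⟨(hcs hy).1.trans (hu.1 hy), hu1,
      mem_closedVectorFuns_of_forall_approx fun ε hε => ?_⟩, fun z hz => hu.1 hz⟩
    -- For d = u - x, 0 ≤ d ≤ 1 implies ‖π(d)ξ‖² ≤ ⟨π(d)ξ, ξ⟩ < δ, so δ is the square of the bound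
    -- wanted for ‖π(d)ξ‖. The 1 avoids dividing by zero.
    set δ : ℝ := (ε / (‖ξ‖ + 1)) ^ 2 with hδ
    obtain ⟨x, hx, hxδ⟩ := exists_re_inner_map_lt_of_isLUB π hne hc hb hu ξ
      (show 0 < δ by positivity)
    refine ⟨_, (hcs hx).2.2, fun z => ?_⟩
    set d := u - x with hd
    have hd0 : 0 ≤ d := sub_nonneg.2 (hu.1 hx)
    have hd1 : d ≤ 1 := (sub_le_self u (hcs hx).1).trans hu1
    obtain ⟨r, hr, hrd⟩ := exists_mul_self_eq hd0
    have hdd : star d * d ≤ d := by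
      have hsd : star d = d := by rw [← hrd, star_mul, hr]
      have h2 : star r * d * r ≤ star r * 1 * r :=
        star_left_conjugate_le_conjugate (show (d : H →L[ℂ] H) ≤ 1 from hd1) (r : H →L[ℂ] H)
      rw [hr, mul_one, hrd] at h2
      calc star d * d = r * d * r := by rw [hsd, ← hrd]; simp only [mul_assoc]
        _ ≤ d := h2
    have hnorm : ‖(π d : L →L[ℂ] L) ξ‖ ≤ ε / (‖ξ‖ + 1) := by
      refine le_of_sq_le_sq ?_ (by positivity)
      rw [norm_sq_apply, ← map_star, ← map_mul]
      refine (re_inner_mono' (starAlgEquiv_mono π hdd) ξ).trans ?_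
      have : (inner ℂ ((π d : L →L[ℂ] L) ξ) ξ : ℂ) =
          inner ℂ ((π u : L →L[ℂ] L) ξ) ξ - inner ℂ ((π x : L →L[ℂ] L) ξ) ξ := by
        rw [hd, map_sub, ← inner_sub_left]
        rfl
      rw [this, Complex.sub_re]
      linarith
    have heq : (vectorFun (reprₗ π) ξ ξ ∘ₗ LinearMap.mulRight ℂ u) z -
        (vectorFun (reprₗ π) ξ ξ ∘ₗ LinearMap.mulRight ℂ x) z =
        inner ℂ ξ ((π z : L →L[ℂ] L) ((π d : L →L[ℂ] L) ξ)) := by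
      simp only [LinearMap.comp_apply, LinearMap.mulRight_apply]
      rw [← map_sub, ← mul_sub, vectorFun_apply, reprₗ_apply, map_mul]
      rfl
    rw [heq]
    refine (norm_inner_le_norm (𝕜 := ℂ) _ _).trans ?_
    have h1 := norm_map_apply_le π z ((π d : L →L[ℂ] L) ξ)
    calc ‖ξ‖ * ‖(π z : L →L[ℂ] L) ((π d : L →L[ℂ] L) ξ)‖
        ≤ (‖ξ‖ + 1) * (‖z‖ * (ε / (‖ξ‖ + 1))) :=
          mul_le_mul (by linarith) (h1.trans (mul_le_mul_of_nonneg_left hnorm (norm_nonneg z)))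
            (norm_nonneg _) (by positivity)
      _ = ε * ‖z‖ := by field_simp) 0 ⟨le_rfl, h01, by
        simp only [LinearMap.mulRight_zero_eq_zero, LinearMap.comp_zero]
        exact Submodule.zero_mem _⟩
  have ha1 : a = 1 := by
    by_contra hne
    obtain ⟨b, hb, hb1, hb0, hbm⟩ := exists_map_mul_eq_vectorFun π ξ (q := 1 - a)
      (sub_nonneg.2 ha.2.1) (sub_le_self _ ha.1) (sub_ne_zero.2 (Ne.symm hne))
    have hmem : a + b ∈ s := by
      refine ⟨add_nonneg ha.1 hb, by rwa [← le_sub_iff_add_le'], ?_⟩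
      have : vectorFun (reprₗ π) ξ ξ ∘ₗ LinearMap.mulRight ℂ (a + b) =
          vectorFun (reprₗ π) ξ ξ ∘ₗ LinearMap.mulRight ℂ a +
          vectorFun (reprₗ π) ξ ξ ∘ₗ LinearMap.mulRight ℂ b := by
        ext x
        simp only [LinearMap.comp_apply, LinearMap.mulRight_apply, LinearMap.add_apply, mul_add,
          map_add]
      rw [this]
      exact Submodule.add_mem _ ha.2.2 hbm
    have := hmax hmem (le_add_of_nonneg_right hb)
    exact hb0 (le_antisymm (by simpa using this) hb)
  have := ha.2.2
  rw [ha1] at this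
  simpa using this

theorem vectorFun_reprₗ_mem (h k : L) : vectorFun (reprₗ π) h k ∈ closedVectorFuns M := by
  -- Polarization reduces the claim to h = k.
  have hpol : (4 : ℂ) • vectorFun (reprₗ π) h k =
      vectorFun (reprₗ π) (h + k) (h + k) - vectorFun (reprₗ π) (h - k) (h - k)
      + Complex.I • vectorFun (reprₗ π) (h + Complex.I • k) (h + Complex.I • k)
      - Complex.I • vectorFun (reprₗ π) (h - Complex.I • k) (h - Complex.I • k) := by
    ext x
    simp only [LinearMap.smul_apply, LinearMap.add_apply, LinearMap.sub_apply, vectorFun_apply,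
      map_add, map_sub, map_smul, inner_add_left, inner_add_right, inner_sub_left,
      inner_sub_right, inner_smul_left, inner_smul_right, smul_eq_mul, Complex.conj_I]
    linear_combination (-2 * inner ℂ h (reprₗ π x k) + 2 * inner ℂ k (reprₗ π x h)) * Complex.I_sq
  have h4 : vectorFun (reprₗ π) h k = (4 : ℂ)⁻¹ • (4 : ℂ) • vectorFun (reprₗ π) h k := by
    rw [smul_smul, inv_mul_cancel₀ (by norm_num), one_smul]
  rw [h4, hpol]
  have hm := vectorFun_reprₗ_self_mem π
  exact Submodule.smul_mem _ _ (Submodule.sub_mem _ (Submodule.add_mem _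
    (Submodule.sub_mem _ (hm _) (hm _)) (Submodule.smul_mem _ _ (hm _)))
    (Submodule.smul_mem _ _ (hm _)))

/-- Isomorphisms of von Neumann algebras pull `σ`-weakly continuous functionals back to norm
limits of vector functionals. -/
theorem vectorFun_ampl_reprₗ_mem (h k : ell2 L) :
    vectorFun (amplₗ ∘ₗ reprₗ π) h k ∈ closedVectorFuns M := by
  refine mem_closedVectorFuns_of_forall_approx fun ε hε => ?_
  have hs := lp.hasSum_single (E := fun _ : ℕ => L) (p := 2) (by norm_num) k
  have hε' : 0 < ε / (‖h‖ + 1) := by positivity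
  -- Truncating k to finitely many coordinates leaves a finite sum of vector functionals; the error
  -- is uniform on the unit ball because π is contractive.
  obtain ⟨t, ht⟩ := (hs.eventually (Metric.ball_mem_nhds k hε')).exists
  refine ⟨∑ n ∈ t, vectorFun (reprₗ π) (h n) (k n), Submodule.sum_mem _ fun n _ =>
    vectorFun_reprₗ_mem π _ _, fun x => ?_⟩
  set k' : ell2 L := ∑ n ∈ t, lp.single 2 n (k n) with hk'
  have heq : (∑ n ∈ t, vectorFun (reprₗ π) (h n) (k n)) x =
      inner ℂ k' (ampl (π x : L →L[ℂ] L) h) := by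
    rw [hk', sum_inner, LinearMap.sum_apply]
    refine Finset.sum_congr rfl fun n _ => ?_
    rw [lp.inner_single_left, ampl_apply, vectorFun_apply, reprₗ_apply]
  have hsub : vectorFun (amplₗ ∘ₗ reprₗ π) h k x - (∑ n ∈ t, vectorFun (reprₗ π) (h n) (k n)) x =
      inner ℂ (k - k') (ampl (π x : L →L[ℂ] L) h) := by
    rw [heq, inner_sub_left, vectorFun_apply, LinearMap.comp_apply, amplₗ_apply, reprₗ_apply]
  have hk : ‖k - k'‖ ≤ ε / (‖h‖ + 1) := by
    rw [← dist_eq_norm, dist_comm]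
    exact (Metric.mem_ball.1 ht).le
  have hπ : ‖(π x : L →L[ℂ] L)‖ ≤ ‖x‖ :=
    ContinuousLinearMap.opNorm_le_bound _ (norm_nonneg x) (norm_map_apply_le π x)
  rw [hsub]
  refine (norm_inner_le_norm (𝕜 := ℂ) _ _).trans ?_
  calc ‖k - k'‖ * ‖ampl (π x : L →L[ℂ] L) h‖
      ≤ ε / (‖h‖ + 1) * (‖x‖ * (‖h‖ + 1)) :=
        mul_le_mul hk (((ampl (π x : L →L[ℂ] L)).le_of_opNorm_le ((norm_ampl_le _).trans hπ) h).trans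
          (mul_le_mul_of_nonneg_left (by linarith) (norm_nonneg x))) (norm_nonneg _) hε'.le
    _ = ε * ‖x‖ := by field_simp

end NormalFunctionals

/-! ### L¹ norms controlled by set integrals -/

section SetIntegrals

variable {Ω : Type*} [MeasurableSpace Ω] {ρ : Measure Ω}

/-- The integral of |f| is that of f over {f ≥ 0} minus that over the complement, each at most m in
modulus. Real and imaginary parts together give the constant 4 of the complex version. -/
theorem integral_abs_le_of_forall_setIntegral {f : Ω → ℝ} (hf : Integrable f ρ)
    (hm : Measurable f) {m : ℝ} (h : ∀ S, MeasurableSet S → |∫ ω in S, f ω ∂ρ| ≤ m) :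
    ∫ ω, |f ω| ∂ρ ≤ 2 * m := by
  have hS : MeasurableSet {ω | 0 ≤ f ω} := measurableSet_le measurable_const hm
  rw [← integral_add_compl hS hf.abs]
  have h1 : ∫ ω in {ω | 0 ≤ f ω}, |f ω| ∂ρ = ∫ ω in {ω | 0 ≤ f ω}, f ω ∂ρ :=
    setIntegral_congr_fun hS fun ω hω => abs_of_nonneg hω
  have h2 : ∫ ω in {ω | 0 ≤ f ω}ᶜ, |f ω| ∂ρ = -∫ ω in {ω | 0 ≤ f ω}ᶜ, f ω ∂ρ := by
    rw [← integral_neg]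
    exact setIntegral_congr_fun hS.compl fun ω hω => abs_of_neg (not_le.1 hω)
  rw [h1, h2]
  linarith [(abs_le.1 (h _ hS)).2, (abs_le.1 (h _ hS.compl)).1]

theorem integral_norm_le_of_forall_setIntegral {f : Ω → ℂ} (hf : Integrable f ρ)
    (hm : Measurable f) {m : ℝ} (h : ∀ S, MeasurableSet S → ‖∫ ω in S, f ω ∂ρ‖ ≤ m) :
    ∫ ω, ‖f ω‖ ∂ρ ≤ 4 * m := by
  have hre : ∫ ω, |(f ω).re| ∂ρ ≤ 2 * m :=
    integral_abs_le_of_forall_setIntegral hf.re (Complex.measurable_re.comp hm) fun S hS => by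
      have : ∫ ω in S, (f ω).re ∂ρ = (∫ ω in S, f ω ∂ρ).re :=
        integral_re (𝕜 := ℂ) hf.integrableOn
      change |∫ ω in S, (f ω).re ∂ρ| ≤ m
      rw [this]
      exact (Complex.abs_re_le_norm _).trans (h S hS)
  have him : ∫ ω, |(f ω).im| ∂ρ ≤ 2 * m :=
    integral_abs_le_of_forall_setIntegral hf.im (Complex.measurable_im.comp hm) fun S hS => by
      have : ∫ ω in S, (f ω).im ∂ρ = (∫ ω in S, f ω ∂ρ).im :=
        integral_im (𝕜 := ℂ) hf.integrableOn
      change |∫ ω in S, (f ω).im ∂ρ| ≤ m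
      rw [this]
      exact (Complex.abs_im_le_norm _).trans (h S hS)
  have hi₁ : Integrable (fun ω => |(f ω).re|) ρ := hf.re.abs
  have hi₂ : Integrable (fun ω => |(f ω).im|) ρ := hf.im.abs
  calc ∫ ω, ‖f ω‖ ∂ρ ≤ ∫ ω, (|(f ω).re| + |(f ω).im|) ∂ρ :=
        integral_mono hf.norm (hi₁.add hi₂) fun ω => Complex.norm_le_abs_re_add_abs_im _
    _ = ∫ ω, |(f ω).re| ∂ρ + ∫ ω, |(f ω).im| ∂ρ := integral_add hi₁ hi₂
    _ ≤ 4 * m := by linarith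

end SetIntegrals

/-! ### Integrals in von Neumann algebras -/

section VonNeumannIntegrals

variable {Ω : Type*} [MeasurableSpace Ω] {ρ : Measure Ω}
variable {H : Type*} [NormedAddCommGroup H] [InnerProductSpace ℂ H] [CompleteSpace H]
  {M : VonNeumannAlgebra H} {G : Ω → M.toStarSubalgebra}

theorem topDual_sigmaOpTopologyOn_vonNeumann (T : OpTop) (M : VonNeumannAlgebra H) :
    topDual (sigmaOpTopologyOn T M.toStarSubalgebra) =
      Submodule.span ℂ (vectorFuns (amplₗ ∘ₗ inclₗ M)) :=
  topDual_induced_sigmaOpTopology T (inclₗ M)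

theorem exists_seq_tendsto_of_mem_closedVectorFuns {ℓ : M.toStarSubalgebra →ₗ[ℂ] ℂ}
    (hℓ : ℓ ∈ closedVectorFuns M) :
    ∃ ψ : ℕ → M.toStarSubalgebra →ₗ[ℂ] ℂ,
      (∀ n, ψ n ∈ Submodule.span ℂ (vectorFuns (inclₗ M))) ∧
      (∀ n x, ‖ℓ x - ψ n x‖ ≤ 1 / ((n : ℝ) + 1) * ‖x‖) ∧
      ∀ x, Filter.Tendsto (fun n => ψ n x) Filter.atTop (𝓝 (ℓ x)) := by
  choose ψ hψ h using fun n : ℕ => hℓ (1 / ((n : ℝ) + 1)) Nat.one_div_pos_of_nat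
  refine ⟨ψ, hψ, h, fun x => ?_⟩
  rw [tendsto_iff_norm_sub_tendsto_zero]
  have h0 : Filter.Tendsto (fun n : ℕ => 1 / ((n : ℝ) + 1) * ‖x‖) Filter.atTop (𝓝 0) := by
    simpa using tendsto_one_div_add_atTop_nhds_zero_nat.mul_const ‖x‖
  refine squeeze_zero (fun _ => norm_nonneg _) (fun n => ?_) h0
  rw [norm_sub_rev]
  exact h n x

theorem measurable_of_mem_closedVectorFuns
    (hG : PointwiseWeaklyMeasurable fun ω => (G ω : H →L[ℂ] H))
    {ℓ : M.toStarSubalgebra →ₗ[ℂ] ℂ} (hℓ : ℓ ∈ closedVectorFuns M) :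
    Measurable fun ω => ℓ (G ω) := by
  obtain ⟨ψ, hψ, -, ht⟩ := exists_seq_tendsto_of_mem_closedVectorFuns hℓ
  refine measurable_of_tendsto_metrizable (fun n => ?_)
    (tendsto_pi_nhds.2 fun ω => ht (G ω))
  refine measurable_of_mem_span ?_ (hψ n)
  rintro _ ⟨⟨h, k⟩, rfl⟩
  exact hG h k

/-- Uniform boundedness twice: an L¹ norm bounds ⟨A S h, k⟩ over all S, hence A S h is bounded for
each h, hence A S. -/
theorem exists_norm_le_of_inner_eq_setIntegral {F : Ω → H →L[ℂ] H}
    (hF : ∀ h k, Integrable (fun ω => (inner ℂ k (F ω h) : ℂ)) ρ)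
    {A : {S : Set Ω // MeasurableSet S} → H →L[ℂ] H}
    (hA : ∀ S h k, inner ℂ k (A S h) = ∫ ω in S.1, inner ℂ k (F ω h) ∂ρ) :
    ∃ C, ∀ S, ‖A S‖ ≤ C := by
  refine banach_steinhaus fun h => ?_
  obtain ⟨C, hC⟩ := banach_steinhaus (g := fun S => innerSL ℂ (A S h)) fun k => by
    refine ⟨∫ ω, ‖(inner ℂ k (F ω h) : ℂ)‖ ∂ρ, fun S => ?_⟩
    rw [innerSL_apply_apply, norm_inner_symm, hA]
    exact (norm_integral_le_integral_norm _).trans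
      (setIntegral_le_integral (hF h k).norm (.of_forall fun _ => norm_nonneg _))
  exact ⟨C, fun S => by simpa using hC S⟩

/-- Weak integrability extends to norm limits of vector functionals. -/
theorem integrable_and_integral_eq_of_mem_closedVectorFuns
    (hG : PointwiseWeaklyMeasurable fun ω => (G ω : H →L[ℂ] H))
    (hi : ∀ h k, Integrable (fun ω => (inner ℂ k ((G ω : H →L[ℂ] H) h) : ℂ)) ρ)
    {A : {S : Set Ω // MeasurableSet S} → M.toStarSubalgebra}
    (hA : ∀ S h k, inner ℂ k ((A S : H →L[ℂ] H) h) =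
      ∫ ω in S.1, inner ℂ k ((G ω : H →L[ℂ] H) h) ∂ρ)
    {ℓ : M.toStarSubalgebra →ₗ[ℂ] ℂ} (hℓ : ℓ ∈ closedVectorFuns M) :
    Integrable (fun ω => ℓ (G ω)) ρ ∧ ∀ S, ℓ (A S) = ∫ ω in S.1, ℓ (G ω) ∂ρ := by
  obtain ⟨C, hC⟩ := exists_norm_le_of_inner_eq_setIntegral hi hA
  have hC0 : 0 ≤ C := (norm_nonneg _).trans (hC ⟨∅, MeasurableSet.empty⟩)
  have hiG : ∀ g ∈ vectorFuns (inclₗ M), Integrable (fun ω => g (G ω)) ρ := by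
    rintro _ ⟨⟨h, k⟩, rfl⟩
    exact hi h k
  have hmG : ∀ g ∈ vectorFuns (inclₗ M), Measurable (fun ω => g (G ω)) := by
    rintro _ ⟨⟨h, k⟩, rfl⟩
    exact hG h k
  obtain ⟨ψ, hψ, hle, ht⟩ := exists_seq_tendsto_of_mem_closedVectorFuns hℓ
  have hψi := fun n => integrable_of_mem_span hiG (hψ n)
  have hψA : ∀ n S, ψ n (A S) = ∫ ω in S.1, ψ n (G ω) ∂ρ := fun n S =>
    integral_eq_of_mem_span hiG (by
      rintro _ ⟨⟨h, k⟩, rfl⟩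
      exact hA S h k) (hψ n)
  have hℓm : Measurable fun ω => ℓ (G ω) := measurable_of_mem_closedVectorFuns hG hℓ
  -- No bound on ‖G ω‖ is available, so norm approximation is applied to the integrals: the set
  -- integrals of ψ m - ψ n along G are its values at A S, at most 2C/(n+1), and four times this
  -- bounds the L¹ distance.
  have hpair : ∀ n m, n ≤ m →
      ∫ ω, ‖ψ m (G ω) - ψ n (G ω)‖ ∂ρ ≤ 8 * C * (1 / ((n : ℝ) + 1)) := by
    intro n m hnm
    have h1 := integral_norm_le_of_forall_setIntegral ((hψi m).sub (hψi n))
      ((measurable_of_mem_span hmG (hψ m)).sub (measurable_of_mem_span hmG (hψ n)))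
      (m := 2 * C * (1 / ((n : ℝ) + 1))) fun S hS => by
        simp only [Pi.sub_apply]
        rw [integral_sub (hψi m).integrableOn (hψi n).integrableOn, ← hψA m ⟨S, hS⟩,
          ← hψA n ⟨S, hS⟩]
        set B := A ⟨S, hS⟩
        have hB : ‖B‖ ≤ C := hC ⟨S, hS⟩
        have hmn : 1 / ((m : ℝ) + 1) ≤ 1 / ((n : ℝ) + 1) := Nat.one_div_le_one_div hnm
        have hn0 : 0 ≤ 1 / ((n : ℝ) + 1) := Nat.one_div_pos_of_nat.le
        calc ‖ψ m B - ψ n B‖ = ‖(ℓ B - ψ n B) - (ℓ B - ψ m B)‖ := by congr 1; ring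
          _ ≤ 1 / ((n : ℝ) + 1) * ‖B‖ + 1 / ((m : ℝ) + 1) * ‖B‖ :=
            (norm_sub_le _ _).trans (add_le_add (hle n B) (hle m B))
          _ ≤ 1 / ((n : ℝ) + 1) * C + 1 / ((n : ℝ) + 1) * C :=
            add_le_add (mul_le_mul_of_nonneg_left hB hn0)
              (mul_le_mul hmn hB (norm_nonneg _) hn0)
          _ = 2 * C * (1 / ((n : ℝ) + 1)) := by ring
    refine h1.trans (le_of_eq (by ring))
  have hlim : ∀ n, ∫⁻ ω, ‖ℓ (G ω) - ψ n (G ω)‖ₑ ∂ρ ≤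
      ENNReal.ofReal (8 * C * (1 / ((n : ℝ) + 1))) := by
    intro n
    -- Fatou's lemma as m → ∞ carries the L¹ bound over to ℓ.
    have hfatou := lintegral_liminf_le (μ := ρ) (u := Filter.atTop)
      (f := fun m ω => ‖ψ m (G ω) - ψ n (G ω)‖ₑ) fun m =>
        ((measurable_of_mem_span hmG (hψ m)).sub (measurable_of_mem_span hmG (hψ n))).enorm
    have heq : ∀ ω, Filter.liminf (fun m => ‖ψ m (G ω) - ψ n (G ω)‖ₑ) Filter.atTop =
        ‖ℓ (G ω) - ψ n (G ω)‖ₑ := fun ω =>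
      (((ht (G ω)).sub_const _).enorm).liminf_eq
    simp only [heq] at hfatou
    refine hfatou.trans (Filter.liminf_le_of_frequently_le' ?_)
    refine (Filter.Eventually.frequently ?_)
    filter_upwards [Filter.eventually_ge_atTop n] with m hm
    refine (ofReal_integral_norm_eq_lintegral_enorm ((hψi m).sub (hψi n))).symm.le.trans ?_
    exact ENNReal.ofReal_le_ofReal (hpair n m hm)
  have hdi : ∀ n, Integrable (fun ω => ℓ (G ω) - ψ n (G ω)) ρ := fun n =>
    integrable_of_lintegral_lt_top (hℓm.sub (measurable_of_mem_span hmG (hψ n)))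
      ((hlim n).trans_lt ENNReal.ofReal_lt_top)
  have hℓi : Integrable (fun ω => ℓ (G ω)) ρ := by
    exact ((hdi 0).add (hψi 0)).congr (.of_forall fun ω => by simp)
  refine ⟨hℓi, fun S => ?_⟩
  have hbound : ∀ n : ℕ, ‖ℓ (A S) - ∫ ω in S.1, ℓ (G ω) ∂ρ‖ ≤
      1 / ((n : ℝ) + 1) * (‖A S‖ + 8 * C) := by
    intro n
    have h1 : ‖∫ ω in S.1, (ℓ (G ω) - ψ n (G ω)) ∂ρ‖ ≤ 8 * C * (1 / ((n : ℝ) + 1)) := by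
      refine (norm_integral_le_integral_norm _).trans ((setIntegral_le_integral (hdi n).norm
        (.of_forall fun _ => norm_nonneg _)).trans ?_)
      rw [← ENNReal.ofReal_le_ofReal_iff (by positivity),
        ofReal_integral_norm_eq_lintegral_enorm (hdi n)]
      exact hlim n
    rw [integral_sub hℓi.integrableOn (hψi n).integrableOn, ← hψA] at h1
    calc ‖ℓ (A S) - ∫ ω in S.1, ℓ (G ω) ∂ρ‖
        = ‖(ℓ (A S) - ψ n (A S)) - (∫ ω in S.1, ℓ (G ω) ∂ρ - ψ n (A S))‖ := by congr 1; ring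
      _ ≤ 1 / ((n : ℝ) + 1) * ‖A S‖ + 8 * C * (1 / ((n : ℝ) + 1)) :=
        (norm_sub_le _ _).trans (add_le_add (hle n _) h1)
      _ = 1 / ((n : ℝ) + 1) * (‖A S‖ + 8 * C) := by ring
  have h0 : Filter.Tendsto (fun n : ℕ => 1 / ((n : ℝ) + 1) * (‖A S‖ + 8 * C)) Filter.atTop
      (𝓝 0) := by
    simpa using tendsto_one_div_add_atTop_nhds_zero_nat.mul_const (‖A S‖ + 8 * C)
  exact sub_eq_zero.1 (norm_le_zero_iff.1 (ge_of_tendsto' h0 hbound))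

theorem inclₗ_ell2_single (M : VonNeumannAlgebra H) (h k : H) :
    vectorFun (amplₗ ∘ₗ inclₗ M) (lp.single 2 0 h) (lp.single 2 0 k) =
      vectorFun (inclₗ M) h k := by
  ext A
  simp only [vectorFun_apply, LinearMap.comp_apply, amplₗ_apply, inner_ampl_single, if_true]

variable {L : Type*} [NormedAddCommGroup L] [InnerProductSpace ℂ L] [CompleteSpace L]
  {N : VonNeumannAlgebra L} (π : M.toStarSubalgebra ≃⋆ₐ[ℂ] N.toStarSubalgebra)

theorem PointwiseWeaklyMeasurable.map_starAlgEquiv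
    (hG : PointwiseWeaklyMeasurable fun ω => (G ω : H →L[ℂ] H)) :
    PointwiseWeaklyMeasurable fun ω => (π (G ω) : L →L[ℂ] L) := fun h k =>
  measurable_of_mem_closedVectorFuns hG (vectorFun_reprₗ_mem π h k)

/-- Each functional on N pulls back to a norm limit of vector functionals on M, so π(A S) is the
integral and no existence argument on L is needed. The hypothesis on G is used only through single
vector functionals. -/
theorem weaklyIntegrable_map_starAlgEquiv {T : OpTop}
    (hG : WeaklyIntegrable (sigmaOpTopologyOn T M.toStarSubalgebra) ρ G) :
    WeaklyIntegrable (sigmaOpTopologyOn T N.toStarSubalgebra) ρ (fun ω => π (G ω)) ∧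
      ∀ S, MeasurableSet S → ∀ A : M.toStarSubalgebra,
        IsWeakIntegral (sigmaOpTopologyOn T M.toStarSubalgebra) ρ G S A →
        IsWeakIntegral (sigmaOpTopologyOn T N.toStarSubalgebra) ρ (fun ω => π (G ω)) S (π A) := by
  obtain ⟨h₁, h₂, h₃⟩ := (weaklyIntegrable_iff (topDual_sigmaOpTopologyOn_vonNeumann T M)).1 hG
  have hmem : ∀ h k : H, vectorFun (inclₗ M) h k ∈ vectorFuns (amplₗ ∘ₗ inclₗ M) := fun h k =>
    ⟨(lp.single 2 0 h, lp.single 2 0 k), inclₗ_ell2_single M h k⟩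
  have hm : PointwiseWeaklyMeasurable fun ω => (G ω : H →L[ℂ] H) := fun h k => h₁ _ (hmem h k)
  have hi : ∀ h k, Integrable (fun ω => (inner ℂ k ((G ω : H →L[ℂ] H) h) : ℂ)) ρ := fun h k =>
    integrable_of_lintegral_lt_top (hm h k) (h₂ _ (hmem h k))
  choose A hA using fun S : {S : Set Ω // MeasurableSet S} => h₃ S.1 S.2
  have key := fun {ℓ : M.toStarSubalgebra →ₗ[ℂ] ℂ} (hℓ : ℓ ∈ closedVectorFuns M) =>
    integrable_and_integral_eq_of_mem_closedVectorFuns hm hi (A := A)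
      (fun S h k => hA S _ (hmem h k)) hℓ
  have hiN : ∀ g ∈ vectorFuns (amplₗ ∘ₗ inclₗ N), Integrable (fun ω => g (π (G ω))) ρ := by
    rintro _ ⟨⟨h, k⟩, rfl⟩
    exact (key (vectorFun_ampl_reprₗ_mem π h k)).1
  have hint : ∀ S, ∀ g ∈ vectorFuns (amplₗ ∘ₗ inclₗ N),
      g (π (A S)) = ∫ ω in S.1, g (π (G ω)) ∂ρ := by
    rintro S _ ⟨⟨h, k⟩, rfl⟩
    exact (key (vectorFun_ampl_reprₗ_mem π h k)).2 S
  refine ⟨(weaklyIntegrable_iff (topDual_sigmaOpTopologyOn_vonNeumann T N)).2 ⟨?_, ?_, ?_⟩, ?_⟩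
  · rintro _ ⟨⟨h, k⟩, rfl⟩
    exact measurable_of_mem_closedVectorFuns hm (vectorFun_ampl_reprₗ_mem π h k)
  · exact fun g hg => (hiN g hg).hasFiniteIntegral
  · exact fun S hS => ⟨π (A ⟨S, hS⟩), hint ⟨S, hS⟩⟩
  · intro S hS B hB
    have hBA : B = A ⟨S, hS⟩ := Subtype.ext <| eq_of_forall_inner_apply fun x y => by
      have h1 := hB (vectorFun (inclₗ M) x y) (by
        rw [topDual_sigmaOpTopologyOn_vonNeumann]
        exact Submodule.subset_span (hmem x y))
      exact h1.trans (hA ⟨S, hS⟩ _ (hmem x y)).symm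
    rw [hBA]
    exact (isWeakIntegral_iff (topDual_sigmaOpTopologyOn_vonNeumann T N) hiN).2 (hint ⟨S, hS⟩)

end VonNeumannIntegrals

end WeakInt

end

-- Describing every notion of integral by "B is an integral iff B = A", with one common A, expresses
-- existence, uniqueness and agreement at once.
open WeakInt in
theorem theorem3p6 {Ω : Type*} [MeasurableSpace Ω] (ρ : Measure Ω)
    {H : Type*} [NormedAddCommGroup H] [InnerProductSpace ℂ H] [CompleteSpace H]
    {K : Type*} [NormedAddCommGroup K] [InnerProductSpace ℂ K] [CompleteSpace K]
    (V : Submodule ℂ (H →L[ℂ] K)) (F : Ω → V) (T : OpTop) :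
    -- generated sigma-algebras and weak measurability
    (sigmaTrace V = sigmaPointwise V ∧
      sigmaPointwise V = sigmaDual (sigmaOpTopologyOn T V) ∧
      sigmaDual (sigmaOpTopologyOn T V) = sigmaDual (opTopologyOn T V) ∧
      (PointwiseWeaklyMeasurable (fun ω => (F ω : H →L[ℂ] K)) ↔
        WeaklyMeasurable (opTopologyOn T V) F) ∧
      (WeaklyMeasurable (opTopologyOn T V) F ↔ WeaklyMeasurable (sigmaOpTopologyOn T V) F)) ∧
    -- integrability in WOT, SOT, S*OT and the triangle inequality
    ((PointwisePettisIntegrableIn V ρ F ↔ WeaklyIntegrable (opTopologyOn T V) ρ F) ∧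
      (WeaklyIntegrable (opTopologyOn T V) ρ F →
        (∀ S, MeasurableSet S → ∃ A : V,
          (∀ B : V, IsWeakIntegral (opTopologyOn T V) ρ F S B ↔ B = A) ∧
          (∀ B : H →L[ℂ] K,
            IsPointwisePettisIntegral ρ (fun ω => (F ω : H →L[ℂ] K)) S B ↔ B = A)) ∧
        (∀ A : V, IsWeakIntegral (opTopologyOn T V) ρ F Set.univ A →
          ‖A‖ₑ ≤ lowerIntegral ρ (fun ω => ‖F ω‖ₑ)))) ∧
    -- integrability in the sigma-topologies and weak* integrability
    (IsClosed[sigmaOpTopology .weak] (V : Set (H →L[ℂ] K)) →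
      (WeaklyIntegrable (sigmaOpTopologyOn T V) ρ F ↔
        WeaklyIntegrable (weakStarTopology V) ρ
          (fun ω => evPredual V (F ω))) ∧
      (WeaklyIntegrable (weakStarTopology V) ρ
          (fun ω => evPredual V (F ω)) ↔
        PointwiseWeaklyMeasurable (fun ω => (F ω : H →L[ℂ] K)) ∧
        ∀ (h : ell2 H) (k : ell2 K),
          ∫⁻ ω, ‖inner ℂ k (ampl (F ω : H →L[ℂ] K) h)‖ₑ ∂ρ < ∞) ∧
      (WeaklyIntegrable (sigmaOpTopologyOn T V) ρ F →
        PointwisePettisIntegrableIn V ρ F ∧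
        ∀ S, MeasurableSet S → ∃ A : V,
          (∀ B : V, IsWeakIntegral (sigmaOpTopologyOn T V) ρ F S B ↔ B = A) ∧
          (∀ Φ : WeakDual ℂ (predual V),
            IsWeakIntegral (weakStarTopology V) ρ (fun ω => evPredual V (F ω)) S Φ ↔
              Φ = evPredual V A) ∧
          (∀ B : H →L[ℂ] K,
            IsPointwisePettisIntegral ρ (fun ω => (F ω : H →L[ℂ] K)) S B ↔ B = A))) ∧
    -- independence of the representation of a von Neumann algebra
    (∀ (M : VonNeumannAlgebra H) (G : Ω → M.toStarSubalgebra)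
      {L : Type*} [NormedAddCommGroup L] [InnerProductSpace ℂ L] [CompleteSpace L]
      (N : VonNeumannAlgebra L) (π : M.toStarSubalgebra ≃⋆ₐ[ℂ] N.toStarSubalgebra),
      (PointwiseWeaklyMeasurable (fun ω => (G ω : H →L[ℂ] H)) ↔
        PointwiseWeaklyMeasurable (fun ω => (π (G ω) : L →L[ℂ] L))) ∧
      (WeaklyIntegrable (sigmaOpTopologyOn T M.toStarSubalgebra) ρ G ↔
        WeaklyIntegrable (sigmaOpTopologyOn T N.toStarSubalgebra) ρ (fun ω => π (G ω))) ∧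
      (WeaklyIntegrable (sigmaOpTopologyOn T M.toStarSubalgebra) ρ G →
        ∀ S, MeasurableSet S → ∀ A : M.toStarSubalgebra,
          IsWeakIntegral (sigmaOpTopologyOn T M.toStarSubalgebra) ρ G S A →
          IsWeakIntegral (sigmaOpTopologyOn T N.toStarSubalgebra) ρ (fun ω => π (G ω)) S
            (π A))) := by
  refine ⟨⟨sigmaTrace_eq_sigmaPointwise V, (sigmaDual_sigmaOpTopologyOn T V).symm, ?_, ?_, ?_⟩,
    ⟨pointwisePettisIntegrableIn_iff V F T, fun hF => ⟨fun S hS => ?_, fun A hA => ?_⟩⟩,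
    fun hV => ⟨?_, ?_, fun hF => ⟨hF.pointwisePettisIntegrableIn, fun S hS => ?_⟩⟩,
    fun M G L _ _ _ N π => ⟨⟨?_, ?_⟩, ⟨?_, ?_⟩, ?_⟩⟩
  · rw [sigmaDual_sigmaOpTopologyOn, sigmaDual_opTopologyOn]
  · rw [WeaklyMeasurable, sigmaDual_opTopologyOn, measurable_sigmaPointwise_iff]
  · rw [WeaklyMeasurable, WeaklyMeasurable, sigmaDual_opTopologyOn, sigmaDual_sigmaOpTopologyOn]
  · obtain ⟨A, hA⟩ := hF.exists_integral S hS
    exact ⟨A, isWeakIntegral_iff_eq hA fun _ => eq_of_topDual_opTopologyOn,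
      isPointwisePettisIntegral_iff_eq hA.inner_eq⟩
  · have hm := ((pointwisePettisIntegrableIn_iff V F T).2 hF).integrable.measurable
    exact enorm_le_lowerIntegral hm fun h k =>
      (hA.inner_eq h k).trans (by rw [Measure.restrict_univ])
  · exact ⟨fun hF => hF.weakStar, fun hF =>
      (weaklyIntegrable_sigmaOpTopologyOn_iff hV F T).2 hF.of_weakStar⟩
  · exact ⟨fun hF => hF.of_weakStar, fun hF =>
      ((weaklyIntegrable_sigmaOpTopologyOn_iff hV F T).2 hF).weakStar⟩
  · obtain ⟨A, hA⟩ := hF.exists_integral S hS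
    exact ⟨A, isWeakIntegral_iff_eq hA fun _ => eq_of_topDual_sigmaOpTopologyOn,
      isWeakIntegral_weakStar_iff_eq hF hA,
      isPointwisePettisIntegral_iff_eq hA.inner_eq_of_sigma⟩
  · exact fun hG => hG.map_starAlgEquiv π
  · intro hG
    simpa using PointwiseWeaklyMeasurable.map_starAlgEquiv (G := fun ω => π (G ω)) π.symm hG
  · exact fun hG => (weaklyIntegrable_map_starAlgEquiv π hG).1
  · intro hG
    simpa using (weaklyIntegrable_map_starAlgEquiv π.symm hG).1
  · exact fun hG => (weaklyIntegrable_map_starAlgEquiv π hG).2
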